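/- Fix $T>0$, $\alpha\in(\tfrac13,\tfrac12]$, nonnegative reals $\beta_0,\beta_1,\beta_2,\beta_3$ and a separable real Banach space $V$. For functions on $[0,T]$ write $\Phi_{s,t}=\Phi_t-\Phi_s$. Let $(W,\mathbb W)$ be an $\alpha$-Hölder nonlinear rough path with growth multi-index $(\beta_0,\dots,\beta_3)$, that is, $W:[0,T]\times V\to V$ and $\mathbb W:[0,T]^2\times V^2\to V$ satisfy the following. (i) For $s\ne t$ in $[0,T]$ the increment $W_{s,t}$ is three times Fréchet differentiable on $V$, and for $k=0,\dots,3$ $$\sup_{s\neq t,\;x\in V}\frac{\|D^kW_{s,t}(x)\|}{|t-s|^{\alpha}(1+\|x\|)^{\beta_k}}<\infty .$$ (ii) For $s\ne t$ in $[0,T]$ the map $\mathbb W_{s,t}$ is twice Fréchet differentiable on $V^2$, and for $k=0,1,2$ $$\sup_{s\neq t,\;x,y\in V}\frac{\|D^k\mathbb W_{s,t}(x,y)\|}{|t-s|^{2\alpha}(1+\|x\|)^{\beta^*_k}(1+\|y\|)^{\beta^{**}_k}}<\infty,\qquad \beta^*_k=\max\{\beta_0,\dots,\beta_k\},\quad \beta^{**}_k=\max\{\beta_1,\dots,\beta_{k+1}\}.$$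 (iii) (Chen's relation) $\mathbb W_{s,t}(x,y)-\mathbb W_{s,u}(x,y)-\mathbb W_{u,t}(x,y)=DW_{u,t}(y)\big(W_{s,u}(x)\big)$ for all $s,u,t\in[0,T]$ and $x,y\in V$. For $\xi\in V$, a solution on $[0,T]$ of the nonlinear rough differential equation $$Y_t=\xi+\int_0^tW(dr,Y_r)$$ is an $\alpha$-Hölder continuous function $Y:[0,T]\to V$ with $Y_0=\xi$ such that $$\sup_{s\neq t\in[0,T]}\frac{\|Y_{s,t}-W_{s,t}(Y_s)\|}{|t-s|^{2\alpha}}<\infty$$ and such that for every $t\in[0,T]$ the equation holds, the integral being the limit, as the mesh of the partition $0=t_0<t_1<\dots<t_n=t$ tends to $0$, of $$\sum_{k=1}^n\big[W_{t_{k-1},t_k}(Y_{t_{k-1}})+\mathbb W_{t_{k-1},t_k}(Y_{t_{k-1}},Y_{t_{k-1}})\big].$$ Theorem. Let $\gamma_2=\max\{\beta_0,\beta_1,\beta_2\}+\max\{\beta_1,\beta_2,\beta_3\}+\beta_1$ and assume $$\frac{\gamma_2}{\alpha}-\gamma_2+\beta_0\le 1 .$$ Then for every $\xi\in V$ the equation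 has a solution on $[0,T]$, and this solution is unique. -/

import Mathlib

namespace NonlinearRough

variable {V : Type*} [NormedAddCommGroup V]

/-- The two-parameter map `R` satisfies the `γ`-Hölder bound on `[0,T]²`: the supremum of
`‖R s t‖ / |t - s|^γ` over `s ≠ t` in `[0,T]` is finite. -/
def IsHolder₂ (T γ : ℝ) (R : ℝ → ℝ → V) : Prop :=
  ∃ C : ℝ, ∀ s ∈ Set.Icc 0 T, ∀ t ∈ Set.Icc 0 T, s ≠ t → ‖R s t‖ ≤ C * |t - s| ^ γ

/-- `Y` is `γ`-Hölder continuous on `[0,T]`. -/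
def IsHolder (T γ : ℝ) (Y : ℝ → V) : Prop :=
  IsHolder₂ T γ fun s t => Y t - Y s

variable [NormedSpace ℝ V]

/-- `f` is `n` times Fréchet differentiable on the whole space (the top derivative need not be
continuous). -/
def NTimesDifferentiable {E F : Type*} [NormedAddCommGroup E] [NormedSpace ℝ E]
    [NormedAddCommGroup F] [NormedSpace ℝ F] (n : ℕ) (f : E → F) : Prop :=
  ∀ k < n, Differentiable ℝ (iteratedFDeriv ℝ k f)

/-- The space `C^{α, (β₀,…,βₙ)}([0,T] × V; V)`: the increments `W_{s,t} = W_t - W_s` are `n` times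
differentiable in space and, for every `k ≤ n`, the supremum over `s ≠ t` and `x` of
`‖Dᵏ W_{s,t}(x)‖ / (|t - s|^α (1 + ‖x‖)^{β_k})` is finite. Only `β 0, …, β n` matter. -/
def MemC (T α : ℝ) (n : ℕ) (β : ℕ → ℝ) (W : ℝ → V → V) : Prop :=
  (∀ s ∈ Set.Icc 0 T, ∀ t ∈ Set.Icc 0 T, s ≠ t →
    NTimesDifferentiable n fun x => W t x - W s x) ∧
  ∃ C : ℝ, ∀ k ≤ n, ∀ s ∈ Set.Icc 0 T, ∀ t ∈ Set.Icc 0 T, s ≠ t → ∀ x : V,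
    ‖iteratedFDeriv ℝ k (fun x => W t x - W s x) x‖ ≤ C * |t - s| ^ α * (1 + ‖x‖) ^ β k

/-- The space `C₂^{α, β¹, β²}([0,T]² × V²; V)` for multi-indices `β¹`, `β²` of length `n + 1`.
The norm of `V × V` in Mathlib is the maximum of the two norms, which is equivalent to their sum, so
that the same maps are differentiable and the same suprema are finite for both. -/
def MemC₂ (T α : ℝ) (n : ℕ) (β₁ β₂ : ℕ → ℝ) (Ψ : ℝ → ℝ → V × V → V) : Prop :=
  (∀ s ∈ Set.Icc 0 T, ∀ t ∈ Set.Icc 0 T, s ≠ t → NTimesDifferentiable n (Ψ s t)) ∧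
  ∃ C : ℝ, ∀ k ≤ n, ∀ s ∈ Set.Icc 0 T, ∀ t ∈ Set.Icc 0 T, s ≠ t → ∀ p : V × V,
    ‖iteratedFDeriv ℝ k (Ψ s t) p‖ ≤
      C * |t - s| ^ α * (1 + ‖p.1‖) ^ β₁ k * (1 + ‖p.2‖) ^ β₂ k

/-- `β*_k = max {β₀, …, β_k}`. -/
def betaStar (β : ℕ → ℝ) (k : ℕ) : ℝ := partialSups β k

/-- `β**_k = max {β₁, …, β_{k+1}}`. -/
def betaStarStar (β : ℕ → ℝ) (k : ℕ) : ℝ := partialSups (fun j => β (j + 1)) k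

/-- `(W, 𝕎)` is an `α`-Hölder nonlinear rough path on `[0,T] × V` with growth multi-index
`(β₀,…,βₙ)`, `n ≥ 1`. -/
structure IsNonlinearRoughPath (T α : ℝ) (n : ℕ) (β : ℕ → ℝ)
    (W : ℝ → V → V) (WW : ℝ → ℝ → V × V → V) : Prop where
  memC : MemC T α n β W
  memC₂ : MemC₂ T (2 * α) (n - 1) (betaStar β) (betaStarStar β) WW
  chen : ∀ s ∈ Set.Icc 0 T, ∀ u ∈ Set.Icc 0 T, ∀ t ∈ Set.Icc 0 T, ∀ x y : V,
    WW s t (x, y) - WW s u (x, y) - WW u t (x, y) =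
      fderiv ℝ (fun z => W t z - W u z) y (W u x - W s x)

/-- `(Y, Y')` is a controlled rough path by `W` on `[0,T]`: both are `α`-Hölder continuous and
the remainder `R_{s,t} = Y_{s,t} - W_{s,t}(Y'_s)` is `2α`-Hölder. -/
structure IsControlled (T α : ℝ) (W : ℝ → V → V) (Y Y' : ℝ → V) : Prop where
  holder : IsHolder T α Y
  holder' : IsHolder T α Y'
  remainder : IsHolder₂ T (2 * α) fun s t => Y t - Y s - (W t (Y' s) - W s (Y' s))

/-- `s = τ₀ < τ₁ < ⋯ < τ_m = t`; only `τ 0, …, τ m` matter. -/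
structure IsPartition (s t : ℝ) (m : ℕ) (τ : ℕ → ℝ) : Prop where
  left : τ 0 = s
  right : τ m = t
  lt : ∀ k < m, τ k < τ (k + 1)

/-- The nonlinear rough integral `∫_s^t W(dr, Y_r)` of the controlled rough path `(Y, Y')` exists
and equals `I`: the sums of `Ξ_{a,b} = W_{a,b}(Y_a) + 𝕎_{a,b}(Y'_a, Y_a)` over the intervals of a
partition of `[s,t]` converge to `I` as the mesh of the partition tends to `0`. -/
def HasRoughIntegral (W : ℝ → V → V) (WW : ℝ → ℝ → V × V → V) (Y Y' : ℝ → V)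
    (s t : ℝ) (I : V) : Prop :=
  ∀ ε > 0, ∃ δ > 0, ∀ (m : ℕ) (τ : ℕ → ℝ), IsPartition s t m τ →
    (∀ k < m, τ (k + 1) - τ k < δ) →
      ‖∑ k ∈ Finset.range m,
          (W (τ (k + 1)) (Y (τ k)) - W (τ k) (Y (τ k))
            + WW (τ k) (τ (k + 1)) (Y' (τ k), Y (τ k))) - I‖ < ε

/-- `Y` solves `Y_t = ξ + ∫_0^t W(dr, Y_r)` on `[0,T]`: the pair `(Y, Y)` is controlled by `W`,
starts at `(ξ, ξ)`, and the equation holds for every `t ∈ [0,T]`. -/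
structure IsSolution (T α : ℝ) (W : ℝ → V → V) (WW : ℝ → ℝ → V × V → V) (ξ : V)
    (Y : ℝ → V) : Prop where
  controlled : IsControlled T α W Y Y
  init : Y 0 = ξ
  eqn : ∀ t ∈ Set.Icc 0 T, ∃ I : V, HasRoughIntegral W WW Y Y 0 t I ∧ Y t = ξ + I

end NonlinearRough

/-! The equation is solved by the Euler scheme with step y ↦ y + W_{s,t}(y) + 𝕎_{s,t}(y,y). By
Chen's relation, two consecutive steps differ from the single step over the union of their intervals
by a term of order |t-s|^{3α} (`step_step_sub`). Since 3α > 1, such defects sum: bisecting index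
intervals (`discrete_sewing`) shows that many steps stay within O(|t-s|^{3α}) of one step, with a
constant independent of the mesh (`euler_block_error`).

The growth condition rules out explosion. Let 1 + ‖y‖ ≤ r at the start, and choose H so that
C(2r)^{γ₂}H^α is a fixed small constant. Over time H the scheme keeps 1 + ‖·‖ ≤ 2r and moves by at
most 3C(2r)^{β₀}H^α. As H is proportional to (2r)^{-γ₂/α}, the inequality γ₂/α - γ₂ + β₀ ≤ 1 says
exactly that this move is at most a constant times rH. Hence 1 + ‖y‖ grows at most exponentially in
time, uniformly in the mesh (`growth_le`, `eul_bound_aux`).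

Everything now happens in a fixed ball, where one constant bounds all derivatives. Sewing the
difference of two schemes shows that the scheme is Lipschitz in its starting point, uniformly in the
mesh (`exists_eul_lip`). A telescoping argument then compares the scheme with any sequence obeying
the recursion up to errors O(h^{3α}): at most T/h errors add up to O(h^{3α-1}), which tends to 0
(`norm_sub_eul_le`). Applied to the scheme of mesh h/2, this gives convergence along dyadic meshes.
The limit inherits the one-step estimate ‖Y_t - step(Y_s)‖ ≤ L|t-s|^{3α} for short times, and this
estimate makes it a solution (`isSolution_of_error`).

For uniqueness, every solution satisfies the same one-step estimate, again by sewing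
(`IsSolution.exists_error`). By the telescoping argument it is the limit of the Euler schemes
started from ξ, and that limit is unique. -/

namespace NonlinearRough

open Set Filter Topology

/-! ### Second-order difference and Taylor remainder estimates on balls. -/

section Calculus

variable {E F : Type*} [NormedAddCommGroup E] [NormedSpace ℝ E]
  [NormedAddCommGroup F] [NormedSpace ℝ F]

theorem norm_lineMap_le {x y : E} {ρ θ : ℝ} (hx : ‖x‖ ≤ ρ) (hy : ‖x + y‖ ≤ ρ)
    (hθ : θ ∈ Icc (0 : ℝ) 1) : ‖x + θ • y‖ ≤ ρ := by
  have h : x + θ • y = (1 - θ) • x + θ • (x + y) := by module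
  rw [h]
  calc ‖(1 - θ) • x + θ • (x + y)‖ ≤ (1 - θ) * ‖x‖ + θ * ‖x + y‖ := by
        refine (norm_add_le _ _).trans ?_
        rw [norm_smul, norm_smul, Real.norm_of_nonneg hθ.1,
          Real.norm_of_nonneg (sub_nonneg.2 hθ.2)]
    _ ≤ (1 - θ) * ρ + θ * ρ := by
        have := hθ.1
        have := sub_nonneg.2 hθ.2
        gcongr
    _ = ρ := by ring

/-- A differentiable map with derivative bounded on a ball is Lipschitz there. -/
theorem norm_sub_le_of_fderiv_le {f : E → F} {ρ m : ℝ} (hf : Differentiable ℝ f)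
    (hm : ∀ x, ‖x‖ ≤ ρ → ‖fderiv ℝ f x‖ ≤ m) {x y : E} (hx : ‖x‖ ≤ ρ) (hy : ‖y‖ ≤ ρ) :
    ‖f x - f y‖ ≤ m * ‖x - y‖ :=
  (convex_closedBall (0 : E) ρ).norm_image_sub_le_of_norm_fderiv_le (𝕜 := ℝ)
    (fun z _ => hf z) (fun z hz => hm z (by simpa using hz)) (by simpa using hy) (by simpa using hx)

theorem hasDerivAt_along {f : E → F} (hf : Differentiable ℝ f) (x v : E) (θ : ℝ) :
    HasDerivAt (fun θ : ℝ => f (x + θ • v)) (fderiv ℝ f (x + θ • v) v) θ := by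
  have h1 : HasDerivAt (fun θ : ℝ => x + θ • v) v θ := by
    simpa using ((hasDerivAt_id θ).smul_const v).const_add x
  exact (hf (x + θ • v)).hasFDerivAt.comp_hasDerivAt θ h1

/-- The four-point estimate: control of a second-order difference of `f`. -/
theorem norm_four_point_le {f : E → F} {ρ m₁ m₂ δ : ℝ} (hf : Differentiable ℝ f)
    (h₁ : ∀ x, ‖x‖ ≤ ρ → ‖fderiv ℝ f x‖ ≤ m₁)
    (h₂ : ∀ x y, ‖x‖ ≤ ρ → ‖y‖ ≤ ρ → ‖fderiv ℝ f x - fderiv ℝ f y‖ ≤ m₂ * ‖x - y‖)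
    (hm₂ : 0 ≤ m₂) {y z v w : E} (hy : ‖y‖ ≤ ρ) (hz : ‖z‖ ≤ ρ)
    (hyv : ‖y + v‖ ≤ ρ) (hzw : ‖z + w‖ ≤ ρ) (hd : ‖y - z‖ ≤ δ) (hd' : ‖y + v - (z + w)‖ ≤ δ) :
    ‖f (y + v) - f y - (f (z + w) - f z)‖ ≤ m₁ * ‖v - w‖ + m₂ * δ * ‖v‖ := by
  have key := norm_image_sub_le_of_norm_deriv_le_segment_01'
    (f := fun θ : ℝ => f (y + θ • v) - f (z + θ • w))
    (C := m₁ * ‖v - w‖ + m₂ * δ * ‖v‖)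
    (fun θ _ => ((hasDerivAt_along hf y v θ).sub (hasDerivAt_along hf z w θ)).hasDerivWithinAt)
    (fun θ hθ => by
      have hθ' : θ ∈ Icc (0 : ℝ) 1 := ⟨hθ.1, hθ.2.le⟩
      have e1 := norm_lineMap_le hy hyv hθ'
      have e2 := norm_lineMap_le hz hzw hθ'
      have e3 : ‖(y + θ • v) - (z + θ • w)‖ ≤ δ := by
        have e : (y + θ • v) - (z + θ • w) = (y - z) + θ • (v - w) := by module
        rw [e]
        exact norm_lineMap_le hd (by convert hd' using 2; abel) hθ'
      have e4 : fderiv ℝ f (y + θ • v) v - fderiv ℝ f (z + θ • w) w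
          = fderiv ℝ f (z + θ • w) (v - w)
            + (fderiv ℝ f (y + θ • v) - fderiv ℝ f (z + θ • w)) v := by
        simp only [map_sub, sub_apply]; abel
      rw [e4]
      refine (norm_add_le _ _).trans (add_le_add ?_ ?_)
      · exact (ContinuousLinearMap.le_opNorm _ _).trans (by gcongr; exact h₁ _ e2)
      · refine (ContinuousLinearMap.le_opNorm _ _).trans ?_
        gcongr
        exact (h₂ _ _ e1 e2).trans (by gcongr))
  convert key using 2
  simp only [one_smul, zero_smul, add_zero]
  abel

/-- Mean value inequality for θ ↦ f(y + θv) - θ Df(y)v. The factor 1/2 of Taylor's formula is lost,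
which is harmless. -/
theorem norm_taylor_le {f : E → F} {ρ m₂ : ℝ} (hf : Differentiable ℝ f)
    (h₂ : ∀ x y, ‖x‖ ≤ ρ → ‖y‖ ≤ ρ → ‖fderiv ℝ f x - fderiv ℝ f y‖ ≤ m₂ * ‖x - y‖)
    (hm₂ : 0 ≤ m₂) {y v : E} (hy : ‖y‖ ≤ ρ) (hyv : ‖y + v‖ ≤ ρ) :
    ‖f (y + v) - f y - fderiv ℝ f y v‖ ≤ m₂ * ‖v‖ ^ 2 := by
  have key := norm_image_sub_le_of_norm_deriv_le_segment_01'
    (f := fun θ : ℝ => f (y + θ • v) - θ • fderiv ℝ f y v)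
    (C := m₂ * ‖v‖ ^ 2)
    (fun θ _ => ((hasDerivAt_along hf y v θ).sub
      ((hasDerivAt_id θ).smul_const (fderiv ℝ f y v))).hasDerivWithinAt)
    (fun θ hθ => by
      have hθ' : θ ∈ Icc (0 : ℝ) 1 := ⟨hθ.1, hθ.2.le⟩
      have e1 := norm_lineMap_le hy hyv hθ'
      rw [one_smul, ← sub_apply, pow_two, ← mul_assoc]
      refine (ContinuousLinearMap.le_opNorm _ _).trans ?_
      gcongr
      refine (h₂ _ _ e1 hy).trans ?_
      gcongr
      rw [add_sub_cancel_left, norm_smul, Real.norm_of_nonneg hθ.1]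
      exact mul_le_of_le_one_left (norm_nonneg _) hθ.2.le)
  convert key using 2
  simp only [one_smul, zero_smul, add_zero]
  abel

/-- The first-order Taylor remainder is Lipschitz in the base point and the increment. -/
theorem norm_taylor_sub_le {f : E → F} {ρ m₂ m₃ δ : ℝ} (hf : Differentiable ℝ f)
    (hf' : Differentiable ℝ (fderiv ℝ f))
    (h₂ : ∀ x, ‖x‖ ≤ ρ → ‖fderiv ℝ (fderiv ℝ f) x‖ ≤ m₂)
    (h₃ : ∀ x y, ‖x‖ ≤ ρ → ‖y‖ ≤ ρ →
      ‖fderiv ℝ (fderiv ℝ f) x - fderiv ℝ (fderiv ℝ f) y‖ ≤ m₃ * ‖x - y‖)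
    (hm₂ : 0 ≤ m₂) (hm₃ : 0 ≤ m₃) {y z v w : E} (hy : ‖y‖ ≤ ρ) (hz : ‖z‖ ≤ ρ)
    (hyv : ‖y + v‖ ≤ ρ) (hzw : ‖z + w‖ ≤ ρ) (hd : ‖y - z‖ ≤ δ) (hd' : ‖y + v - (z + w)‖ ≤ δ) :
    ‖f (y + v) - f y - fderiv ℝ f y v - (f (z + w) - f z - fderiv ℝ f z w)‖ ≤
      (m₂ * ‖v - w‖ + m₃ * δ * ‖v‖) * ‖v‖ + m₂ * ‖w‖ * ‖v - w‖ := by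
  have hδ : 0 ≤ δ := (norm_nonneg _).trans hd
  have key := norm_image_sub_le_of_norm_deriv_le_segment_01'
    (f := fun θ : ℝ => f (y + θ • v) - θ • fderiv ℝ f y v
      - (f (z + θ • w) - θ • fderiv ℝ f z w))
    (C := (m₂ * ‖v - w‖ + m₃ * δ * ‖v‖) * ‖v‖ + m₂ * ‖w‖ * ‖v - w‖)
    (fun θ _ => (((hasDerivAt_along hf y v θ).sub
      ((hasDerivAt_id θ).smul_const (fderiv ℝ f y v))).sub
      ((hasDerivAt_along hf z w θ).sub
      ((hasDerivAt_id θ).smul_const (fderiv ℝ f z w)))).hasDerivWithinAt)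
    (fun θ hθ => by
      have hθ' : θ ∈ Icc (0 : ℝ) 1 := ⟨hθ.1, hθ.2.le⟩
      have hθn : ∀ u : E, ‖θ • u‖ ≤ ‖u‖ := fun u => by
        rw [norm_smul, Real.norm_of_nonneg hθ.1]
        exact mul_le_of_le_one_left (norm_nonneg _) hθ.2.le
      have e1 := norm_lineMap_le hy hyv hθ'
      have e2 := norm_lineMap_le hz hzw hθ'
      have e3 : ‖(y + θ • v) - (z + θ • w)‖ ≤ δ := by
        have e : (y + θ • v) - (z + θ • w) = (y - z) + θ • (v - w) := by module
        rw [e]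
        exact norm_lineMap_le hd (by convert hd' using 2; abel) hθ'
      have e4 : fderiv ℝ f (y + θ • v) v - (1 : ℝ) • fderiv ℝ f y v
            - (fderiv ℝ f (z + θ • w) w - (1 : ℝ) • fderiv ℝ f z w)
          = (fderiv ℝ f (y + θ • v) - fderiv ℝ f y
              - (fderiv ℝ f (z + θ • w) - fderiv ℝ f z)) v
            + (fderiv ℝ f (z + θ • w) - fderiv ℝ f z) (v - w) := by
        simp only [map_sub, sub_apply, one_smul]; abel
      rw [e4]
      refine (norm_add_le _ _).trans (add_le_add ?_ ?_)
      · refine (ContinuousLinearMap.le_opNorm _ _).trans ?_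
        gcongr
        -- The four-point estimate is applied to the derivative of `f`, with increments θv and θw.
        refine (norm_four_point_le hf' h₂ h₃ hm₃ hy hz e1 e2 hd e3).trans ?_
        rw [← smul_sub]
        gcongr
        · exact hθn _
        · exact hθn _
      · refine (ContinuousLinearMap.le_opNorm _ _).trans ?_
        gcongr
        refine (norm_sub_le_of_fderiv_le hf' h₂ e2 hz).trans ?_
        rw [add_sub_cancel_left]
        gcongr
        exact hθn _)
  convert key using 2
  simp only [one_smul, zero_smul, add_zero]
  abel

end Calculus

/-! ### The discrete sewing lemma. -/

section Sewing

/-- The constant of the discrete sewing lemma with exponent `p > 1`. -/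
noncomputable def sewConst (p : ℝ) : ℝ := 2 / (1 - (2 / 3 : ℝ) ^ (p - 1))

theorem sewRatio_lt_one {p : ℝ} (hp : 1 < p) : (2 / 3 : ℝ) ^ (p - 1) < 1 :=
  Real.rpow_lt_one (by norm_num) (by norm_num) (by linarith)

theorem sewConst_pos {p : ℝ} (hp : 1 < p) : 0 < sewConst p :=
  div_pos two_pos (sub_pos.2 (sewRatio_lt_one hp))

/-- One factor x is left untouched on the right, so that the bounds for two adjacent pieces of an
interval of length y add up to (2/3)^{p-1} y^p. -/
theorem rpow_le_ratio_mul {p x y : ℝ} (hp : 1 < p) (hx : 0 ≤ x) (hxy : x ≤ 2 / 3 * y) :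
    x ^ p ≤ (2 / 3 : ℝ) ^ (p - 1) * y ^ (p - 1) * x := by
  rcases hx.eq_or_lt with rfl | hx'
  · simp [Real.zero_rpow (by linarith : p ≠ 0)]
  · have hy : 0 ≤ y := by linarith
    rw [← Real.mul_rpow (by norm_num) hy]
    calc x ^ p = x ^ (p - 1) * x := by
          rw [← Real.rpow_add_one hx'.ne']; ring_nf
      _ ≤ _ := by gcongr

/-- Discrete sewing lemma on a uniform grid of mesh `h`. -/
theorem discrete_sewing {p ε κ h : ℝ} (hp : 1 < p) (hε : 0 ≤ ε)
    (hεp : (1 + ε) * (2 / 3 : ℝ) ^ (p - 1) ≤ (1 + (2 / 3 : ℝ) ^ (p - 1)) / 2)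
    (hκ : 0 ≤ κ) (hh : 0 ≤ h) {m : ℕ} {A : ℕ → ℕ → ℝ}
    (hA : ∀ i < m, A i (i + 1) ≤ 0)
    (hAs : ∀ i j k, i < j → j < k → k ≤ m →
      A i k ≤ (1 + ε) * A i j + A j k + κ * (((k : ℝ) - i) * h) ^ p) :
    ∀ i k, i < k → k ≤ m → A i k ≤ sewConst p * κ * (((k : ℝ) - i) * h) ^ p := by
  set ρ := (2 / 3 : ℝ) ^ (p - 1) with hρ
  have hρ1 : ρ < 1 := sewRatio_lt_one hp
  set L := sewConst p * κ with hL
  have hL0 : 0 ≤ L := mul_nonneg (sewConst_pos hp).le hκ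
  -- `sewConst` is chosen so that L is the fixed point of L ↦ (1+ρ)/2 · L + κ; this closes the
  -- induction.
  have hLκ : (1 + ρ) / 2 * L + κ = L := by
    have : 1 - ρ ≠ 0 := (sub_pos.2 hρ1).ne'
    rw [hL, sewConst, ← hρ]
    field_simp
    ring
  suffices H : ∀ n i k, k - i = n → i < k → k ≤ m →
      A i k ≤ L * (((k : ℝ) - i) * h) ^ p from fun i k hik hk => H _ i k rfl hik hk
  intro n
  induction n using Nat.strong_induction_on with
  | _ n ih =>
    intro i k hn hik hk
    by_cases h1 : k = i + 1
    · subst h1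
      refine (hA i (by omega)).trans (mul_nonneg hL0 (Real.rpow_nonneg ?_ _))
      push_cast
      have : (i : ℝ) + 1 - i = 1 := by ring
      rw [this]; linarith
    · obtain ⟨j, hj⟩ : ∃ j, j = i + (k - i) / 2 := ⟨_, rfl⟩
      have hij : i < j := by omega
      have hjk : j < k := by omega
      -- As k - i ≥ 2, the rounded midpoint leaves at most two thirds on either side; the worst case
      -- is k - i = 3.
      have c1 : ((j : ℝ) - i) ≤ 2 / 3 * ((k : ℝ) - i) := by
        have : 3 * j ≤ 2 * k + i := by omega
        have : (3 * j : ℝ) ≤ 2 * k + i := by exact_mod_cast this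
        linarith
      have c2 : ((k : ℝ) - j) ≤ 2 / 3 * ((k : ℝ) - i) := by
        have : k + 2 * i ≤ 3 * j := by omega
        have : (k + 2 * i : ℝ) ≤ 3 * j := by exact_mod_cast this
        linarith
      have d1 : (0 : ℝ) ≤ (j : ℝ) - i := sub_nonneg.2 (by exact_mod_cast hij.le)
      have d2 : (0 : ℝ) ≤ (k : ℝ) - j := sub_nonneg.2 (by exact_mod_cast hjk.le)
      have d3 : (0 : ℝ) < (k : ℝ) - i := sub_pos.2 (by exact_mod_cast hik)
      set τ := ((k : ℝ) - i) * h with hτ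
      have hτ0 : 0 ≤ τ := by positivity
      have b1 := rpow_le_ratio_mul hp (mul_nonneg d1 hh) (y := τ) (by rw [hτ]; nlinarith)
      have b2 := rpow_le_ratio_mul hp (mul_nonneg d2 hh) (y := τ) (by rw [hτ]; nlinarith)
      have hτp : τ ^ (p - 1) * τ = τ ^ p := by
        rcases hτ0.eq_or_lt with h0 | h0
        · rw [← h0]; simp [Real.zero_rpow (by linarith : p ≠ 0)]
        · rw [← Real.rpow_add_one h0.ne']; ring_nf
      have bsum : (((j : ℝ) - i) * h) ^ p + (((k : ℝ) - j) * h) ^ p ≤ ρ * τ ^ p := by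
        calc _ ≤ ρ * τ ^ (p - 1) * (((j : ℝ) - i) * h) + ρ * τ ^ (p - 1) * (((k : ℝ) - j) * h) :=
              add_le_add b1 b2
          _ = ρ * (τ ^ (p - 1) * τ) := by rw [hτ]; ring
          _ = _ := by rw [hτp]
      have i1 := ih (j - i) (by omega) i j rfl hij (by omega)
      have i2 := ih (k - j) (by omega) j k rfl hjk hk
      have hp2 : 0 ≤ (((k : ℝ) - j) * h) ^ p := by positivity
      calc A i k ≤ (1 + ε) * A i j + A j k + κ * τ ^ p := hAs i j k hij hjk hk
        _ ≤ (1 + ε) * (L * (((j : ℝ) - i) * h) ^ p)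
              + (1 + ε) * (L * (((k : ℝ) - j) * h) ^ p) + κ * τ ^ p := by
            gcongr
            refine i2.trans (le_mul_of_one_le_left (mul_nonneg hL0 hp2) (by linarith))
        _ = (1 + ε) * L * ((((j : ℝ) - i) * h) ^ p + (((k : ℝ) - j) * h) ^ p) + κ * τ ^ p := by
            ring
        _ ≤ (1 + ε) * L * (ρ * τ ^ p) + κ * τ ^ p := by gcongr
        _ = ((1 + ε) * ρ * L + κ) * τ ^ p := by ring
        _ ≤ ((1 + ρ) / 2 * L + κ) * τ ^ p := by gcongr
        _ = L * τ ^ p := by rw [hLκ]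

end Sewing

/-! ### Derivative bounds on balls. -/

section Bounds

variable {E F : Type*} [NormedAddCommGroup E] [NormedSpace ℝ E]
  [NormedAddCommGroup F] [NormedSpace ℝ F]

theorem NTimesDifferentiable.differentiable {n : ℕ} {f : E → F}
    (h : NTimesDifferentiable (n + 1) f) : Differentiable ℝ f := by
  have := h 0 (Nat.succ_pos n)
  rw [iteratedFDeriv_zero_eq_comp] at this
  exact (LinearIsometryEquiv.comp_differentiable_iff _).1 this

theorem NTimesDifferentiable.fderiv {n : ℕ} {f : E → F}
    (h : NTimesDifferentiable (n + 1) f) : NTimesDifferentiable n (fderiv ℝ f) := by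
  intro k hk
  have := h (k + 1) (Nat.succ_lt_succ hk)
  have e : iteratedFDeriv ℝ (k + 1) f = (continuousMultilinearCurryRightEquiv' ℝ k E F).symm ∘
      iteratedFDeriv ℝ k (_root_.fderiv ℝ f) := funext fun _ => iteratedFDeriv_succ_eq_comp_right
  rw [e] at this
  exact (LinearIsometryEquiv.comp_differentiable_iff _).1 this

variable {V : Type*} [NormedAddCommGroup V] [NormedSpace ℝ V]

/-- The increment `W_{s,t}` of a time-dependent vector field. -/
def inc (W : ℝ → V → V) (s t : ℝ) : V → V := fun x => W t x - W s x

/-- The restriction of `𝕎_{s,t}` to the diagonal. -/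
def dia (WW : ℝ → ℝ → V × V → V) (s t : ℝ) : V → V := fun x => WW s t (x, x)

/-- Bounds for a nonlinear rough path and its derivatives on the ball of radius `ρ`. -/
structure BoundsOn (T α : ℝ) (W : ℝ → V → V) (WW : ℝ → ℝ → V × V → V) (ρ : ℝ)
    (m n : ℕ → ℝ) : Prop where
  diff_inc : ∀ s ∈ Icc 0 T, ∀ t ∈ Icc 0 T, Differentiable ℝ (inc W s t)
  diff_inc' : ∀ s ∈ Icc 0 T, ∀ t ∈ Icc 0 T, Differentiable ℝ (fderiv ℝ (inc W s t))
  diff_inc'' : ∀ s ∈ Icc 0 T, ∀ t ∈ Icc 0 T,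
    Differentiable ℝ (fderiv ℝ (fderiv ℝ (inc W s t)))
  diff_dia : ∀ s ∈ Icc 0 T, ∀ t ∈ Icc 0 T, Differentiable ℝ (dia WW s t)
  nonneg : ∀ k, 0 ≤ m k
  nonneg' : ∀ k, 0 ≤ n k
  inc_le : ∀ s ∈ Icc 0 T, ∀ t ∈ Icc 0 T, ∀ x, ‖x‖ ≤ ρ → ‖inc W s t x‖ ≤ m 0 * |t - s| ^ α
  inc'_le : ∀ s ∈ Icc 0 T, ∀ t ∈ Icc 0 T, ∀ x, ‖x‖ ≤ ρ →
    ‖fderiv ℝ (inc W s t) x‖ ≤ m 1 * |t - s| ^ α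
  inc''_le : ∀ s ∈ Icc 0 T, ∀ t ∈ Icc 0 T, ∀ x, ‖x‖ ≤ ρ →
    ‖fderiv ℝ (fderiv ℝ (inc W s t)) x‖ ≤ m 2 * |t - s| ^ α
  inc'''_le : ∀ s ∈ Icc 0 T, ∀ t ∈ Icc 0 T, ∀ x, ‖x‖ ≤ ρ →
    ‖fderiv ℝ (fderiv ℝ (fderiv ℝ (inc W s t))) x‖ ≤ m 3 * |t - s| ^ α
  dia_le : ∀ s ∈ Icc 0 T, ∀ t ∈ Icc 0 T, ∀ x, ‖x‖ ≤ ρ →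
    ‖dia WW s t x‖ ≤ n 0 * |t - s| ^ (2 * α)
  dia'_le : ∀ s ∈ Icc 0 T, ∀ t ∈ Icc 0 T, ∀ x, ‖x‖ ≤ ρ →
    ‖fderiv ℝ (dia WW s t) x‖ ≤ n 1 * |t - s| ^ (2 * α)
  dia'_lip : ∀ s ∈ Icc 0 T, ∀ t ∈ Icc 0 T, ∀ x y, ‖x‖ ≤ ρ → ‖y‖ ≤ ρ →
    ‖fderiv ℝ (dia WW s t) x - fderiv ℝ (dia WW s t) y‖ ≤ n 2 * |t - s| ^ (2 * α) * ‖x - y‖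

omit [NormedSpace ℝ V] in
theorem inc_self (W : ℝ → V → V) (s : ℝ) : inc W s s = fun _ => 0 := by
  funext x; simp [inc]

/-- The growth bounds only concern s ≠ t. Chen's relation with all three times equal supplies the
diagonal. -/
theorem IsNonlinearRoughPath.self_eq_zero {T α : ℝ} {n : ℕ} {β : ℕ → ℝ} {W : ℝ → V → V}
    {WW : ℝ → ℝ → V × V → V} (h : IsNonlinearRoughPath T α n β W WW) {s : ℝ}
    (hs : s ∈ Icc 0 T) (p : V × V) : WW s s p = 0 := by
  have := h.chen s hs s hs s hs p.1 p.2
  simpa using this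

theorem dia_eq (WW : ℝ → ℝ → V × V → V) (s t : ℝ) :
    dia WW s t = WW s t ∘ ((ContinuousLinearMap.id ℝ V).prod (ContinuousLinearMap.id ℝ V)) := rfl

theorem fderiv_dia {WW : ℝ → ℝ → V × V → V} {s t : ℝ} (h : Differentiable ℝ (WW s t)) (x : V) :
    fderiv ℝ (dia WW s t) x = (fderiv ℝ (WW s t) (x, x)).comp
      ((ContinuousLinearMap.id ℝ V).prod (ContinuousLinearMap.id ℝ V)) := by
  rw [dia_eq]
  exact ((h _).hasFDerivAt.comp x (ContinuousLinearMap.hasFDerivAt _)).fderiv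

theorem norm_diag_le :
    ‖(ContinuousLinearMap.id ℝ V).prod (ContinuousLinearMap.id ℝ V)‖ ≤ 1 :=
  ContinuousLinearMap.opNorm_le_bound _ zero_le_one fun x => by simp [Prod.norm_def]

/-- The weights are monotone because the exponents are nonnegative, and on the diagonal the two
weights of 𝕎 merge into one exponent β*_k + β**_k. It matters for the a priori bound that `C` does
not depend on ρ. -/
theorem IsNonlinearRoughPath.exists_boundsOn {T α : ℝ} (hα : 0 < α) {β : ℕ → ℝ}
    (hβ : ∀ k ≤ 3, 0 ≤ β k) {W : ℝ → V → V} {WW : ℝ → ℝ → V × V → V}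
    (h : IsNonlinearRoughPath T α 3 β W WW) :
    ∃ C : ℝ, 1 ≤ C ∧ ∀ ρ, 0 ≤ ρ → BoundsOn T α W WW ρ (fun k => C * (1 + ρ) ^ β k)
      (fun k => C * (1 + ρ) ^ (betaStar β k + betaStarStar β k)) := by
  obtain ⟨hd, C₁, hC₁⟩ := h.memC
  obtain ⟨hd₂, C₂, hC₂⟩ := h.memC₂
  have hs1 : ∀ k ≤ 2, 0 ≤ betaStar β k := fun k hk =>
    (hβ k (by omega)).trans (le_partialSups β k)
  have hs2 : ∀ k ≤ 2, 0 ≤ betaStarStar β k := fun k hk =>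
    (hβ (k + 1) (by omega)).trans (le_partialSups (fun j => β (j + 1)) k)
  set C := max 1 (max C₁ C₂) with hC
  have hC1 : 1 ≤ C := le_max_left _ _
  have hCC₁ : C₁ ≤ C := (le_max_left _ _).trans (le_max_right _ _)
  have hCC₂ : C₂ ≤ C := (le_max_right _ _).trans (le_max_right _ _)
  have hC0 : 0 ≤ C := zero_le_one.trans hC1
  refine ⟨C, hC1, fun ρ hρ => ?_⟩
  have hα2 : 2 * α ≠ 0 := by positivity
  have D : ∀ s ∈ Icc 0 T, ∀ t ∈ Icc 0 T, NTimesDifferentiable 3 (inc W s t) := by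
    intro s hs t ht
    by_cases hst : s = t
    · subst hst
      rw [inc_self]
      intro k _
      exact (contDiff_const (n := ⊤)).differentiable_iteratedFDeriv (by exact_mod_cast WithTop.coe_lt_top _)
    · exact hd s hs t ht hst
  have Dz : ∀ s ∈ Icc 0 T, WW s s = fun _ => 0 := fun s hs =>
    funext fun p => h.self_eq_zero hs p
  have D₂ : ∀ s ∈ Icc 0 T, ∀ t ∈ Icc 0 T, NTimesDifferentiable 2 (WW s t) := by
    intro s hs t ht
    by_cases hst : s = t
    · subst hst
      rw [Dz s hs]
      intro k _
      exact (contDiff_const (n := ⊤)).differentiable_iteratedFDeriv (by exact_mod_cast WithTop.coe_lt_top _)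
    · exact hd₂ s hs t ht hst
  have B : ∀ k ≤ 3, ∀ s ∈ Icc 0 T, ∀ t ∈ Icc 0 T, ∀ x, ‖x‖ ≤ ρ →
      ‖iteratedFDeriv ℝ k (inc W s t) x‖ ≤ C * (1 + ρ) ^ β k * |t - s| ^ α := by
    intro k hk s hs t ht x hx
    by_cases hst : s = t
    · subst hst
      rw [inc_self, sub_self, abs_zero, Real.zero_rpow hα.ne', mul_zero]
      simp
    · refine (hC₁ k hk s hs t ht hst x).trans ?_
      have := hβ k hk
      calc C₁ * |t - s| ^ α * (1 + ‖x‖) ^ β k ≤ C * |t - s| ^ α * (1 + ρ) ^ β k := by gcongr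
        _ = _ := by ring
  have B₂ : ∀ k ≤ 2, ∀ s ∈ Icc 0 T, ∀ t ∈ Icc 0 T, ∀ p : V × V, ‖p‖ ≤ ρ →
      ‖iteratedFDeriv ℝ k (WW s t) p‖ ≤
        C * (1 + ρ) ^ (betaStar β k + betaStarStar β k) * |t - s| ^ (2 * α) := by
    intro k hk s hs t ht p hp
    by_cases hst : s = t
    · subst hst
      rw [Dz s hs, sub_self, abs_zero, Real.zero_rpow hα2, mul_zero]
      simp
    · refine (hC₂ k hk s hs t ht hst p).trans ?_
      have h1 := hs1 k hk
      have h2 := hs2 k hk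
      have p1 := (norm_fst_le p).trans hp
      have p2 := (norm_snd_le p).trans hp
      rw [Real.rpow_add (by linarith)]
      calc C₂ * |t - s| ^ (2 * α) * (1 + ‖p.1‖) ^ betaStar β k * (1 + ‖p.2‖) ^ betaStarStar β k
          ≤ C * |t - s| ^ (2 * α) * (1 + ρ) ^ betaStar β k * (1 + ρ) ^ betaStarStar β k := by
            gcongr
        _ = _ := by ring
  have hpair : ∀ x : V, ‖x‖ ≤ ρ → ‖((x, x) : V × V)‖ ≤ ρ := fun x hx => by
    simpa [Prod.norm_def] using hx
  refine ⟨fun s hs t ht => (D s hs t ht).differentiable,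
    fun s hs t ht => (D s hs t ht).fderiv.differentiable,
    fun s hs t ht => (D s hs t ht).fderiv.fderiv.differentiable,
    fun s hs t ht => ?_, fun k => by positivity, fun k => by positivity, ?_, ?_, ?_, ?_, ?_, ?_, ?_⟩
  · rw [dia_eq]
    exact (D₂ s hs t ht).differentiable.comp (ContinuousLinearMap.differentiable _)
  · intro s hs t ht x hx
    simpa using B 0 (by norm_num) s hs t ht x hx
  · intro s hs t ht x hx
    have := B 1 (by norm_num) s hs t ht x hx
    rwa [← norm_iteratedFDeriv_fderiv, norm_iteratedFDeriv_zero] at this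
  · intro s hs t ht x hx
    have := B 2 (by norm_num) s hs t ht x hx
    rwa [← norm_iteratedFDeriv_fderiv, ← norm_iteratedFDeriv_fderiv,
      norm_iteratedFDeriv_zero] at this
  · intro s hs t ht x hx
    have := B 3 (by norm_num) s hs t ht x hx
    rwa [← norm_iteratedFDeriv_fderiv, ← norm_iteratedFDeriv_fderiv,
      ← norm_iteratedFDeriv_fderiv, norm_iteratedFDeriv_zero] at this
  · intro s hs t ht x hx
    simpa [dia] using B₂ 0 (by norm_num) s hs t ht (x, x) (hpair x hx)
  · intro s hs t ht x hx
    have := B₂ 1 (by norm_num) s hs t ht (x, x) (hpair x hx)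
    rw [← norm_iteratedFDeriv_fderiv, norm_iteratedFDeriv_zero] at this
    rw [fderiv_dia (D₂ s hs t ht).differentiable]
    refine (ContinuousLinearMap.opNorm_comp_le _ _).trans ?_
    exact (mul_le_of_le_one_right (norm_nonneg _) norm_diag_le).trans this
  -- The Lipschitz bound is taken from D²𝕎 on V × V, so no second derivative of the diagonal map has
  -- to be computed.
  · intro s hs t ht x y hx hy
    rw [fderiv_dia (D₂ s hs t ht).differentiable, fderiv_dia (D₂ s hs t ht).differentiable,
      ← ContinuousLinearMap.sub_comp]
    refine (ContinuousLinearMap.opNorm_comp_le _ _).trans ?_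
    refine (mul_le_of_le_one_right (norm_nonneg _) norm_diag_le).trans ?_
    refine (norm_sub_le_of_fderiv_le (D₂ s hs t ht).fderiv.differentiable (ρ := ρ)
      (m := C * (1 + ρ) ^ (betaStar β 2 + betaStarStar β 2) * |t - s| ^ (2 * α)) (fun p hp => ?_) (hpair x hx) (hpair y hy)).trans_eq ?_
    · have := B₂ 2 le_rfl s hs t ht p hp
      rwa [← norm_iteratedFDeriv_fderiv, ← norm_iteratedFDeriv_fderiv,
        norm_iteratedFDeriv_zero] at this
    · simp [Prod.norm_def]

end Bounds

/-! ### One Euler step and the defect of two steps against one. -/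

section Step

variable {V : Type*} [NormedAddCommGroup V]

/-- The displacement `W_{s,t}(y) + 𝕎_{s,t}(y, y)` of one Euler step. -/
def disp (W : ℝ → V → V) (WW : ℝ → ℝ → V × V → V) (s t : ℝ) (y : V) : V :=
  inc W s t y + dia WW s t y

/-- One Euler step from time `s` to time `t`. -/
def step (W : ℝ → V → V) (WW : ℝ → ℝ → V × V → V) (s t : ℝ) (y : V) : V :=
  y + disp W WW s t y

/-- The Euler scheme of mesh `h` started from `y` at time `s`. -/
def eul (W : ℝ → V → V) (WW : ℝ → ℝ → V × V → V) (h s : ℝ) (y : V) : ℕ → V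
  | 0 => y
  | n + 1 => step W WW (s + n * h) (s + (n + 1) * h) (eul W WW h s y n)

variable [NormedSpace ℝ V] {T α ρ : ℝ} {W : ℝ → V → V} {WW : ℝ → ℝ → V × V → V} {m n : ℕ → ℝ}

/-- Chen's relation on the diagonal. -/
def ChenDiag (T : ℝ) (W : ℝ → V → V) (WW : ℝ → ℝ → V × V → V) : Prop :=
  ∀ s ∈ Icc 0 T, ∀ u ∈ Icc 0 T, ∀ t ∈ Icc 0 T, ∀ x : V,
    dia WW s t x = dia WW s u x + dia WW u t x + fderiv ℝ (inc W u t) x (inc W s u x)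

theorem IsNonlinearRoughPath.chenDiag {N : ℕ} {β : ℕ → ℝ}
    (h : IsNonlinearRoughPath T α N β W WW) : ChenDiag T W WW := by
  intro s hs u hu t ht x
  have := h.chen s hs u hu t ht x x
  unfold dia inc
  rw [← this]; abel

/-- Chen's relation cancels the term DW_{u,t}(W_{s,u}). What is left is a Taylor remainder of
W_{u,t}, a term DW·𝕎 and an increment of 𝕎, each of order 3α in time. -/
theorem step_step_sub (hc : ChenDiag T W WW) {s u t : ℝ} (hs : s ∈ Icc 0 T) (hu : u ∈ Icc 0 T)
    (ht : t ∈ Icc 0 T) (y : V) :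
    step W WW u t (step W WW s u y) - step W WW s t y =
      (inc W u t (y + disp W WW s u y) - inc W u t y
        - fderiv ℝ (inc W u t) y (disp W WW s u y))
      + fderiv ℝ (inc W u t) y (dia WW s u y)
      + (dia WW u t (y + disp W WW s u y) - dia WW u t y) := by
  have e : inc W s t y = inc W s u y + inc W u t y := by simp [inc]
  have e2 := hc s hs u hu t ht y
  have e3 : fderiv ℝ (inc W u t) y (disp W WW s u y)
      = fderiv ℝ (inc W u t) y (inc W s u y) + fderiv ℝ (inc W u t) y (dia WW s u y) := by
    rw [disp, map_add]
  rw [e3]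
  simp only [step]
  rw [show disp W WW s t y = inc W s t y + dia WW s t y from rfl, e, e2,
    show disp W WW u t (y + disp W WW s u y) = inc W u t (y + disp W WW s u y)
      + dia WW u t (y + disp W WW s u y) from rfl]
  have e4 : disp W WW s u y = inc W s u y + dia WW s u y := rfl
  generalize inc W u t (y + disp W WW s u y) = A
  generalize dia WW u t (y + disp W WW s u y) = B
  rw [e4]
  abel

theorem abs_rpow_two_mul (x α : ℝ) : |x| ^ (2 * α) = (|x| ^ α) ^ 2 := by
  rw [mul_comm, Real.rpow_mul (abs_nonneg x)]; norm_cast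

theorem rpow_three_mul {x : ℝ} (hx : 0 ≤ x) (α : ℝ) : x ^ (3 * α) = (x ^ α) ^ 3 := by
  rw [mul_comm, Real.rpow_mul hx]; norm_cast

namespace BoundsOn

variable (h : BoundsOn T α W WW ρ m n) {s t u a : ℝ} (hs : s ∈ Icc 0 T) (ht : t ∈ Icc 0 T)
  (ha : |t - s| ^ α ≤ a)
include h hs ht ha

/-- In these estimates `a` is any upper bound of |t-s|^α, so that all subintervals of a block can be
measured by one quantity. -/
theorem inc_le_of {x : V} (hx : ‖x‖ ≤ ρ) : ‖inc W s t x‖ ≤ m 0 * a :=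
  (h.inc_le s hs t ht x hx).trans (mul_le_mul_of_nonneg_left ha (h.nonneg _))

theorem inc'_le_of {x : V} (hx : ‖x‖ ≤ ρ) : ‖fderiv ℝ (inc W s t) x‖ ≤ m 1 * a :=
  (h.inc'_le s hs t ht x hx).trans (mul_le_mul_of_nonneg_left ha (h.nonneg _))

theorem inc''_le_of {x : V} (hx : ‖x‖ ≤ ρ) : ‖fderiv ℝ (fderiv ℝ (inc W s t)) x‖ ≤ m 2 * a :=
  (h.inc''_le s hs t ht x hx).trans (mul_le_mul_of_nonneg_left ha (h.nonneg _))

theorem inc_lip {x y : V} (hx : ‖x‖ ≤ ρ) (hy : ‖y‖ ≤ ρ) :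
    ‖inc W s t x - inc W s t y‖ ≤ m 1 * a * ‖x - y‖ :=
  norm_sub_le_of_fderiv_le (h.diff_inc s hs t ht) (fun _ hz => h.inc'_le_of hs ht ha hz) hx hy

theorem inc'_lip {x y : V} (hx : ‖x‖ ≤ ρ) (hy : ‖y‖ ≤ ρ) :
    ‖fderiv ℝ (inc W s t) x - fderiv ℝ (inc W s t) y‖ ≤ m 2 * a * ‖x - y‖ :=
  norm_sub_le_of_fderiv_le (h.diff_inc' s hs t ht) (fun _ hz => h.inc''_le_of hs ht ha hz) hx hy

theorem inc''_lip {x y : V} (hx : ‖x‖ ≤ ρ) (hy : ‖y‖ ≤ ρ) :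
    ‖fderiv ℝ (fderiv ℝ (inc W s t)) x - fderiv ℝ (fderiv ℝ (inc W s t)) y‖
      ≤ m 3 * a * ‖x - y‖ :=
  norm_sub_le_of_fderiv_le (h.diff_inc'' s hs t ht) (fun z hz => (h.inc'''_le s hs t ht z hz).trans
    (mul_le_mul_of_nonneg_left ha (h.nonneg _))) hx hy

theorem dia_le_of {x : V} (hx : ‖x‖ ≤ ρ) : ‖dia WW s t x‖ ≤ n 0 * a ^ 2 := by
  refine (h.dia_le s hs t ht x hx).trans (mul_le_mul_of_nonneg_left ?_ (h.nonneg' _))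
  rw [abs_rpow_two_mul]; gcongr

theorem dia'_le_of {x : V} (hx : ‖x‖ ≤ ρ) : ‖fderiv ℝ (dia WW s t) x‖ ≤ n 1 * a ^ 2 := by
  refine (h.dia'_le s hs t ht x hx).trans (mul_le_mul_of_nonneg_left ?_ (h.nonneg' _))
  rw [abs_rpow_two_mul]; gcongr

theorem dia_lip {x y : V} (hx : ‖x‖ ≤ ρ) (hy : ‖y‖ ≤ ρ) :
    ‖dia WW s t x - dia WW s t y‖ ≤ n 1 * a ^ 2 * ‖x - y‖ :=
  norm_sub_le_of_fderiv_le (h.diff_dia s hs t ht) (fun _ hz => h.dia'_le_of hs ht ha hz) hx hy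

theorem dia'_lip_of {x y : V} (hx : ‖x‖ ≤ ρ) (hy : ‖y‖ ≤ ρ) :
    ‖fderiv ℝ (dia WW s t) x - fderiv ℝ (dia WW s t) y‖ ≤ n 2 * a ^ 2 * ‖x - y‖ := by
  refine (h.dia'_lip s hs t ht x y hx hy).trans ?_
  have := h.nonneg' 2
  rw [abs_rpow_two_mul]; gcongr

theorem disp_le {x : V} (hx : ‖x‖ ≤ ρ) : ‖disp W WW s t x‖ ≤ m 0 * a + n 0 * a ^ 2 :=
  (norm_add_le _ _).trans (add_le_add (h.inc_le_of hs ht ha hx) (h.dia_le_of hs ht ha hx))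

theorem disp_lip {x y : V} (hx : ‖x‖ ≤ ρ) (hy : ‖y‖ ≤ ρ) :
    ‖disp W WW s t x - disp W WW s t y‖ ≤ (m 1 * a + n 1 * a ^ 2) * ‖x - y‖ := by
  have e : disp W WW s t x - disp W WW s t y
      = (inc W s t x - inc W s t y) + (dia WW s t x - dia WW s t y) := by
    simp only [disp]; abel
  rw [e, add_mul]
  exact (norm_add_le _ _).trans (add_le_add (h.inc_lip hs ht ha hx hy) (h.dia_lip hs ht ha hx hy))

theorem step_lip {x y : V} (hx : ‖x‖ ≤ ρ) (hy : ‖y‖ ≤ ρ) :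
    ‖step W WW s t x - step W WW s t y‖ ≤ (1 + (m 1 * a + n 1 * a ^ 2)) * ‖x - y‖ := by
  have e : step W WW s t x - step W WW s t y
      = (x - y) + (disp W WW s t x - disp W WW s t y) := by
    simp only [step]; abel
  rw [e, add_mul, one_mul]
  exact (norm_add_le _ _).trans (add_le_add le_rfl (h.disp_lip hs ht ha hx hy))

theorem disp_four_point {y z v w : V} {δ : ℝ} (hy : ‖y‖ ≤ ρ) (hz : ‖z‖ ≤ ρ)
    (hyv : ‖y + v‖ ≤ ρ) (hzw : ‖z + w‖ ≤ ρ) (hd : ‖y - z‖ ≤ δ) (hd' : ‖y + v - (z + w)‖ ≤ δ) :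
    ‖disp W WW s t (y + v) - disp W WW s t y - (disp W WW s t (z + w) - disp W WW s t z)‖
      ≤ (m 1 * a + n 1 * a ^ 2) * ‖v - w‖ + (m 2 * a + n 2 * a ^ 2) * δ * ‖v‖ := by
  have ha0 : 0 ≤ a := (Real.rpow_nonneg (abs_nonneg _) _).trans ha
  have b1 := norm_four_point_le (h.diff_inc s hs t ht) (fun _ hz => h.inc'_le_of hs ht ha hz)
    (fun _ _ hx hy => h.inc'_lip hs ht ha hx hy) (mul_nonneg (h.nonneg 2) ha0)
    hy hz hyv hzw hd hd'
  have b2 := norm_four_point_le (h.diff_dia s hs t ht) (fun _ hz => h.dia'_le_of hs ht ha hz)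
    (fun _ _ hx hy => h.dia'_lip_of hs ht ha hx hy) (mul_nonneg (h.nonneg' 2) (sq_nonneg a))
    hy hz hyv hzw hd hd'
  have e : disp W WW s t (y + v) - disp W WW s t y - (disp W WW s t (z + w) - disp W WW s t z)
      = (inc W s t (y + v) - inc W s t y - (inc W s t (z + w) - inc W s t z))
        + (dia WW s t (y + v) - dia WW s t y - (dia WW s t (z + w) - dia WW s t z)) := by
    simp only [disp]; abel
  rw [e]
  refine (norm_add_le _ _).trans ((add_le_add b1 b2).trans_eq ?_)
  ring

variable (hu : u ∈ Icc 0 T) (ha' : |u - t| ^ α ≤ a) (hc : ChenDiag T W WW)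
include hu ha' hc

theorem defect_le {y : V} (hy : ‖y‖ ≤ ρ) (hy' : ‖step W WW s t y‖ ≤ ρ) :
    ‖step W WW t u (step W WW s t y) - step W WW s u y‖ ≤
      m 2 * a * ‖disp W WW s t y‖ ^ 2 + m 1 * a * (n 0 * a ^ 2)
        + n 1 * a ^ 2 * ‖disp W WW s t y‖ := by
  have ha0 : 0 ≤ a := (Real.rpow_nonneg (abs_nonneg _) _).trans ha
  rw [step_step_sub hc hs ht hu]
  refine (norm_add₃_le).trans (add_le_add (add_le_add ?_ ?_) ?_)
  · exact norm_taylor_le (h.diff_inc t ht u hu) (fun _ _ hx hy => h.inc'_lip ht hu ha' hx hy)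
      (mul_nonneg (h.nonneg 2) ha0) hy hy'
  · refine (ContinuousLinearMap.le_opNorm _ _).trans ?_
    have := h.nonneg 1
    gcongr
    · exact h.inc'_le_of ht hu ha' hy
    · exact h.dia_le_of hs ht ha hy
  · refine (h.dia_lip ht hu ha' hy' hy).trans_eq ?_
    rw [step, add_sub_cancel_left]

/-- The three terms of `step_step_sub` are differenced between two starting points. Here δ controls
the distance before and after the step, η the difference of the displacements and v their sizes. The
third derivative of W enters through the difference of Taylor remainders. -/
theorem defect_lip {y z : V} {δ η : ℝ} (hy : ‖y‖ ≤ ρ) (hy' : ‖step W WW s t y‖ ≤ ρ)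
    (hz : ‖z‖ ≤ ρ) (hz' : ‖step W WW s t z‖ ≤ ρ)
    (hd : ‖y - z‖ ≤ δ) (hd' : ‖step W WW s t y - step W WW s t z‖ ≤ δ)
    (hη : ‖disp W WW s t y - disp W WW s t z‖ ≤ η) {v : ℝ} (hv : ‖disp W WW s t y‖ ≤ v)
    (hw : ‖disp W WW s t z‖ ≤ v) :
    ‖step W WW t u (step W WW s t y) - step W WW s u y
      - (step W WW t u (step W WW s t z) - step W WW s u z)‖ ≤
      ((m 2 * a * η + m 3 * a * δ * v) * v + m 2 * a * v * η)
        + (m 1 * a * (n 1 * a ^ 2 * δ) + m 2 * a * δ * (n 0 * a ^ 2))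
        + (n 1 * a ^ 2 * η + n 2 * a ^ 2 * δ * v) := by
  have ha0 : 0 ≤ a := (Real.rpow_nonneg (abs_nonneg _) _).trans ha
  have hδ0 : 0 ≤ δ := (norm_nonneg _).trans hd
  have hη0 : 0 ≤ η := (norm_nonneg _).trans hη
  have hv0 : 0 ≤ v := (norm_nonneg _).trans hv
  have m1 := h.nonneg 1
  have m2 := h.nonneg 2
  have m3 := h.nonneg 3
  have n0 := h.nonneg' 0
  have n1 := h.nonneg' 1
  have n2 := h.nonneg' 2
  rw [step_step_sub hc hs ht hu, step_step_sub hc hs ht hu]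
  rw [add_sub_add_comm, add_sub_add_comm]
  refine (norm_add₃_le).trans (add_le_add (add_le_add ?_ ?_) ?_)
  · refine (norm_taylor_sub_le (h.diff_inc t ht u hu) (h.diff_inc' t ht u hu)
      (fun _ hx => h.inc''_le_of ht hu ha' hx)
      (fun _ _ hx hy => h.inc''_lip ht hu ha' hx hy)
      (mul_nonneg m2 ha0) (mul_nonneg m3 ha0) hy hz hy' hz' hd hd').trans ?_
    gcongr
  · have e : fderiv ℝ (inc W t u) y (dia WW s t y) - fderiv ℝ (inc W t u) z (dia WW s t z)
        = fderiv ℝ (inc W t u) y (dia WW s t y - dia WW s t z)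
          + (fderiv ℝ (inc W t u) y - fderiv ℝ (inc W t u) z) (dia WW s t z) := by
      simp only [map_sub, sub_apply]; abel
    rw [e]
    refine (norm_add_le _ _).trans (add_le_add ?_ ?_)
    · refine (ContinuousLinearMap.le_opNorm _ _).trans ?_
      gcongr
      · exact h.inc'_le_of ht hu ha' hy
      · exact (h.dia_lip hs ht ha hy hz).trans (by gcongr)
    · refine (ContinuousLinearMap.le_opNorm _ _).trans ?_
      gcongr
      · exact (h.inc'_lip ht hu ha' hy hz).trans (by gcongr)
      · exact h.dia_le_of hs ht ha hz
  · refine (norm_four_point_le (h.diff_dia t ht u hu) (fun _ hz => h.dia'_le_of ht hu ha' hz)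
      (fun _ _ hx hy => h.dia'_lip_of ht hu ha' hx hy) (mul_nonneg n2 (sq_nonneg a))
      hy hz hy' hz' hd hd').trans ?_
    gcongr

end BoundsOn

end Step

/-! ### Error and size of the scheme over one block of steps. -/

section Block

/-- The smallness threshold for one block of Euler steps. -/
noncomputable def smallConst (p : ℝ) : ℝ := (1 - (2 / 3 : ℝ) ^ (p - 1)) / 16

theorem smallConst_pos {p : ℝ} (hp : 1 < p) : 0 < smallConst p :=
  div_pos (sub_pos.2 (sewRatio_lt_one hp)) (by norm_num)

theorem smallConst_le (p : ℝ) : smallConst p ≤ 1 / 16 := by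
  have : 0 < (2 / 3 : ℝ) ^ (p - 1) := by positivity
  unfold smallConst; linarith

theorem smallConst_ratio {p x : ℝ} (hp : 1 < p) (hx : x ≤ 2 * smallConst p) :
    (1 + x) * (2 / 3 : ℝ) ^ (p - 1) ≤ (1 + (2 / 3 : ℝ) ^ (p - 1)) / 2 := by
  have h1 := sewRatio_lt_one hp
  have h0 : 0 < (2 / 3 : ℝ) ^ (p - 1) := by positivity
  unfold smallConst at hx
  nlinarith

/-- The sewing constant blows up as p tends to 1. The threshold is proportional to its inverse, so
their product is an absolute constant. -/
theorem sewConst_mul_smallConst {p : ℝ} (hp : 1 < p) : sewConst p * smallConst p = 1 / 8 := by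
  have : 1 - (2 / 3 : ℝ) ^ (p - 1) ≠ 0 := (sub_pos.2 (sewRatio_lt_one hp)).ne'
  unfold sewConst smallConst
  field_simp
  norm_num

variable {V : Type*} [NormedAddCommGroup V] [NormedSpace ℝ V] {T α ρ : ℝ} {W : ℝ → V → V}
  {WW : ℝ → ℝ → V × V → V} {m n : ℕ → ℝ}

/-- Size relations between the bounds of a nonlinear rough path on a ball. -/
structure Sized (m n : ℕ → ℝ) (C B G : ℝ) : Prop where
  one_le : 1 ≤ C
  nonneg_B : 0 ≤ B
  one_le_G : 1 ≤ G
  m0 : m 0 ≤ C * B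
  m1 : m 1 ≤ C * G
  m2 : m 2 * B ≤ C * G
  n0 : n 0 ≤ C * B * G
  n1 : n 1 ≤ C * G

variable {C B G a : ℝ}

namespace Sized

variable (hz : Sized m n C B G) (ha : 0 ≤ a) (hsmall : C * G * a ≤ 1 / 16)
include hz ha hsmall

theorem le_one : a ≤ 1 ∧ G * a ≤ 1 / 16 := by
  have h1 := hz.one_le
  have h2 := hz.one_le_G
  have : G * a ≤ C * G * a := by
    rw [mul_assoc]; exact le_mul_of_one_le_left (by positivity) h1
  refine ⟨?_, this.trans hsmall⟩
  nlinarith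

/-- `B` is the scale of displacements and `G` that of Lipschitz factors. Smallness of G a lets the W
part of a step dominate the 𝕎 part. -/
theorem disp_size : m 0 * a + n 0 * a ^ 2 ≤ 2 * C * B * a := by
  have h1 := hz.one_le
  have h2 := hz.one_le_G
  have hB := hz.nonneg_B
  obtain ⟨_, hGa⟩ := hz.le_one ha hsmall
  calc m 0 * a + n 0 * a ^ 2 ≤ C * B * a + C * B * G * a ^ 2 := by
        gcongr
        exacts [hz.m0, hz.n0]
    _ = C * B * a * (1 + G * a) := by ring
    _ ≤ C * B * a * (1 + 1) := by gcongr; linarith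
    _ = _ := by ring

theorem lip_size : m 1 * a + n 1 * a ^ 2 ≤ 2 * (C * G * a) := by
  have h1 := hz.one_le
  have h2 := hz.one_le_G
  obtain ⟨ha1, _⟩ := hz.le_one ha hsmall
  calc m 1 * a + n 1 * a ^ 2 ≤ C * G * a + C * G * a ^ 2 := by
        gcongr
        exacts [hz.m1, hz.n1]
    _ = C * G * a * (1 + a) := by ring
    _ ≤ C * G * a * (1 + 1) := by gcongr
    _ = _ := by ring

omit hsmall in
-- The Taylor term contains m₂B², which is why `Sized` bounds the product m₂B and not m₂ alone. The
-- result is 7(CGa)²(CBa): a small multiple of the displacement scale.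
theorem defect_size {v : ℝ} (hv0 : 0 ≤ v) (hv : v ≤ 2 * C * B * a) (hm : ∀ k, 0 ≤ m k)
    (hn : ∀ k, 0 ≤ n k) :
    m 2 * a * v ^ 2 + m 1 * a * (n 0 * a ^ 2) + n 1 * a ^ 2 * v ≤ 7 * C ^ 3 * G ^ 2 * B * a ^ 3 := by
  have h1 := hz.one_le
  have h2 := hz.one_le_G
  have hB := hz.nonneg_B
  have := hm 1
  have := hm 2
  have := hn 0
  calc m 2 * a * v ^ 2 + m 1 * a * (n 0 * a ^ 2) + n 1 * a ^ 2 * v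
      ≤ m 2 * a * (2 * C * B * a) ^ 2 + C * G * a * (C * B * G * a ^ 2)
          + C * G * a ^ 2 * (2 * C * B * a) := by
        gcongr
        exacts [hz.m1, hz.n0, hz.n1]
    _ = (m 2 * B) * (4 * C ^ 2 * B * a ^ 3) + C ^ 2 * G ^ 2 * B * a ^ 3
          + 2 * C ^ 2 * G * B * a ^ 3 := by ring
    _ ≤ (C * G) * (4 * C ^ 2 * B * a ^ 3) + C ^ 2 * G ^ 2 * B * a ^ 3
          + 2 * C ^ 2 * G * B * a ^ 3 := by
        have := mul_le_mul_of_nonneg_right hz.m2 (by positivity : 0 ≤ 4 * C ^ 2 * B * a ^ 3)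
        linarith
    _ = 4 * (C ^ 3 * G * B * a ^ 3) + C ^ 2 * G ^ 2 * B * a ^ 3
          + 2 * (C ^ 2 * G * B * a ^ 3) := by ring
    _ ≤ 4 * (C ^ 3 * G ^ 2 * B * a ^ 3) + C ^ 3 * G ^ 2 * B * a ^ 3
          + 2 * (C ^ 3 * G ^ 2 * B * a ^ 3) := by
        have c1 : C ^ 2 ≤ C ^ 3 := pow_le_pow_right₀ h1 (by norm_num)
        have c2 : G ≤ G ^ 2 := le_self_pow₀ h2 (by norm_num)
        gcongr
    _ = _ := by ring

end Sized

theorem grid_mem {s₀ h : ℝ} {M : ℕ} (hs₀ : 0 ≤ s₀) (hh : 0 ≤ h) (hT : s₀ + M * h ≤ T) {k : ℕ}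
    (hk : k ≤ M) : s₀ + k * h ∈ Icc 0 T := by
  constructor
  · positivity
  · refine le_trans ?_ hT
    have : (k : ℝ) ≤ M := by exact_mod_cast hk
    gcongr

theorem grid_abs_rpow_le {s₀ h : ℝ} {i j M : ℕ} (hα : 0 ≤ α) (hh : 0 ≤ h) (hij : i ≤ j)
    (hj : j ≤ i + M) :
    |s₀ + j * h - (s₀ + i * h)| ^ α ≤ (M * h) ^ α := by
  have e : s₀ + j * h - (s₀ + i * h) = ((j : ℝ) - i) * h := by ring
  have h1 : (0 : ℝ) ≤ (j : ℝ) - i := sub_nonneg.2 (by exact_mod_cast hij)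
  have h2 : (j : ℝ) ≤ i + M := by exact_mod_cast hj
  rw [e, abs_of_nonneg (by positivity)]
  gcongr
  linarith

/-- Within a block, an Euler scheme stays close to its one-step approximations. -/
theorem euler_block_error (hp : 1 < 3 * α) (hb : BoundsOn T α W WW ρ m n)
    (hc : ChenDiag T W WW) (hz : Sized m n C B G) {s₀ h : ℝ} {M : ℕ} (hs₀ : 0 ≤ s₀)
    (hh : 0 ≤ h) (hT : s₀ + M * h ≤ T) (hsmall : C * G * (M * h) ^ α ≤ smallConst (3 * α))
    {y : ℕ → V} (hy : ∀ k < M, y (k + 1) = step W WW (s₀ + k * h) (s₀ + (k + 1 : ℕ) * h) (y k))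
    (hball : ∀ k ≤ M, ‖y k‖ + 2 * C * B * (M * h) ^ α ≤ ρ) :
    ∀ i j, i < j → j ≤ M → ‖y j - step W WW (s₀ + i * h) (s₀ + j * h) (y i)‖ ≤
      sewConst (3 * α) * (7 * C ^ 3 * G ^ 2 * B) * (((j : ℝ) - i) * h) ^ (3 * α) := by
  have hα : 0 ≤ α := by linarith
  have hC := hz.one_le
  have hG := hz.one_le_G
  have hB := hz.nonneg_B
  set a := ((M : ℝ) * h) ^ α with ha
  have ha0 : 0 ≤ a := by positivity
  have hs16 : C * G * a ≤ 1 / 16 := hsmall.trans (smallConst_le _)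
  have hmem : ∀ k ≤ M, s₀ + k * h ∈ Icc 0 T := fun k hk => grid_mem hs₀ hh hT hk
  have hyρ : ∀ k ≤ M, ‖y k‖ ≤ ρ := fun k hk => by
    have := hball k hk
    have : 0 ≤ 2 * C * B * a := by positivity
    linarith
  have hdisp : ∀ i j, i ≤ j → j ≤ M →
      ‖disp W WW (s₀ + i * h) (s₀ + j * h) (y i)‖ ≤ 2 * C * B * a := fun i j hij hj =>
    (hb.disp_le (hmem i (hij.trans hj)) (hmem j hj)
      (grid_abs_rpow_le hα hh hij (by omega)) (hyρ i (hij.trans hj))).trans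
      (hz.disp_size ha0 hs16)
  have hstep : ∀ i j, i ≤ j → j ≤ M → ‖step W WW (s₀ + i * h) (s₀ + j * h) (y i)‖ ≤ ρ :=
    fun i j hij hj => (norm_add_le _ _).trans
      ((add_le_add le_rfl (hdisp i j hij hj)).trans (hball i (hij.trans hj)))
  refine discrete_sewing hp (ε := 2 * (C * G * a)) (by positivity)
    (smallConst_ratio hp (by linarith)) (by positivity) hh (fun i hi => ?_) ?_
  · rw [hy i hi, sub_self, norm_zero]
  · intro i j k hij hjk hk
    -- The defect is measured by the scale `b` of the subinterval, whose cube is the required power;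
    -- the Lipschitz factor 1 + ε uses the scale `a` of the whole block.
    set b := (((k : ℝ) - i) * h) ^ α with hbdef
    have hki : (0 : ℝ) ≤ (k : ℝ) - i := sub_nonneg.2 (by exact_mod_cast (hij.trans hjk).le)
    have hkih : 0 ≤ ((k : ℝ) - i) * h := by positivity
    have hb0 : 0 ≤ b := by positivity
    have hcast : (((k - i : ℕ) : ℝ)) = (k : ℝ) - i := by
      rw [Nat.cast_sub (hij.trans hjk).le]
    have hba : b ≤ a := by
      have : (k : ℝ) ≤ M := by exact_mod_cast hk
      have : (0 : ℝ) ≤ i := by positivity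
      rw [hbdef, ha]; gcongr; linarith
    have hbs16 : C * G * b ≤ 1 / 16 := le_trans (by gcongr) hs16
    have r1 : |s₀ + j * h - (s₀ + i * h)| ^ α ≤ b := by
      rw [hbdef, ← hcast]; exact grid_abs_rpow_le hα hh hij.le (by omega)
    have r2 : |s₀ + k * h - (s₀ + j * h)| ^ α ≤ b := by
      rw [hbdef, ← hcast]; exact grid_abs_rpow_le hα hh hjk.le (by omega)
    have mi := hmem i (by omega)
    have mj := hmem j (by omega)
    have mk := hmem k hk
    have d1 := hb.defect_le mi mj r1 mk r2 hc (hyρ i (by omega)) (hstep i j hij.le (by omega))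
    have d2 := hz.defect_size hb0 (norm_nonneg _) ((hb.disp_le mi mj r1
      (hyρ i (by omega))).trans (hz.disp_size hb0 hbs16)) hb.nonneg hb.nonneg'
    have d3 := hb.step_lip mj mk (grid_abs_rpow_le (M := M) hα hh hjk.le (by omega))
      (hyρ j (by omega)) (hstep i j hij.le (by omega))
    have d4 : (1 + (m 1 * a + n 1 * a ^ 2)) ≤ 1 + 2 * (C * G * a) := by
      have := hz.lip_size ha0 hs16
      linarith
    rw [rpow_three_mul hkih]
    set Y := step W WW (s₀ + i * h) (s₀ + j * h) (y i)
    -- The error on [i,k] is the error on [i,j] carried through one step over [j,k], plus the error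
    -- on [j,k], plus the two-step defect.
    have e : y k - step W WW (s₀ + i * h) (s₀ + k * h) (y i)
        = (step W WW (s₀ + j * h) (s₀ + k * h) (y j) - step W WW (s₀ + j * h) (s₀ + k * h) Y)
          + (y k - step W WW (s₀ + j * h) (s₀ + k * h) (y j))
          + (step W WW (s₀ + j * h) (s₀ + k * h) Y
            - step W WW (s₀ + i * h) (s₀ + k * h) (y i)) := by abel
    rw [e]
    refine (norm_add₃_le).trans (add_le_add (add_le_add ?_ le_rfl) (d1.trans d2))
    exact d3.trans (by gcongr)

/-- A priori bound for an Euler scheme over one block. -/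
theorem euler_block_bound (hp : 1 < 3 * α) {r : ℝ} (hr : 1 ≤ r)
    (hb : BoundsOn T α W WW (2 * r - 1) m n)
    (hc : ChenDiag T W WW) (hz : Sized m n C B G) (hBG : B ≤ G) {s₀ h : ℝ} {M : ℕ} (hs₀ : 0 ≤ s₀)
    (hh : 0 ≤ h) (hT : s₀ + M * h ≤ T) (hsmall : C * G * (M * h) ^ α ≤ smallConst (3 * α))
    {y : ℕ → V} (hy0 : 1 + ‖y 0‖ ≤ r)
    (hy : ∀ k < M, y (k + 1) = step W WW (s₀ + k * h) (s₀ + (k + 1 : ℕ) * h) (y k)) :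
    ∀ k ≤ M, ‖y k - y 0‖ ≤ 3 * C * B * (M * h) ^ α := by
  have hα : 0 ≤ α := by linarith
  have hC := hz.one_le
  have hG := hz.one_le_G
  have hB := hz.nonneg_B
  have hsc := smallConst_le (3 * α)
  have hCBG : ∀ a : ℝ, 0 ≤ a → C * B * a ≤ C * G * a := fun a ha => by gcongr
  -- Bootstrap: the bound up to index k keeps the points up to k + 1 inside the ball, with room for
  -- one more step. So `euler_block_error` applies up to k + 1 and returns the bound there: 2CBa
  -- from a single step plus CBa from the sewing error.
  have key : ∀ k ≤ M, ∀ l ≤ k, ‖y l - y 0‖ ≤ 3 * C * B * (M * h) ^ α := by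
    intro k
    induction k with
    | zero =>
      intro _ l hl
      obtain rfl : l = 0 := by omega
      rw [sub_self, norm_zero]; positivity
    | succ k ih =>
      intro hk l hl
      rcases Nat.lt_or_ge l (k + 1) with hl' | hl'
      · exact ih (by omega) l (by omega)
      obtain rfl : l = k + 1 := by omega
      set a := ((M : ℝ) * h) ^ α with ha
      have ha0 : 0 ≤ a := by positivity
      have hsa := hCBG a ha0
      have hs16 : C * G * a ≤ 1 / 16 := hsmall.trans hsc
      have hk1 : ∀ l ≤ k, ‖y l‖ ≤ 2 * r - 1 - 2 * C * B * a := fun l hl => by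
        have h1 := ih (by omega) l hl
        have h2 : ‖y l‖ ≤ ‖y l - y 0‖ + ‖y 0‖ := by simpa using norm_add_le (y l - y 0) (y 0)
        nlinarith
      have hmem : ∀ k ≤ M, s₀ + k * h ∈ Icc 0 T := fun k hk => grid_mem hs₀ hh hT hk
      have hdisp : ∀ i j, i ≤ j → j ≤ k + 1 → i ≤ k →
          ‖disp W WW (s₀ + i * h) (s₀ + j * h) (y i)‖ ≤ 2 * C * B * a := fun i j hij hj hi =>
        (hb.disp_le (hmem i (by omega)) (hmem j (by omega))
          (grid_abs_rpow_le hα hh hij (by omega)) (by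
            have := hk1 i hi
            have : 0 ≤ 2 * C * B * a := by positivity
            linarith)).trans
          (hz.disp_size ha0 hs16)
      have hk2 : ∀ l ≤ k + 1, ‖y l‖ + 2 * C * B * a ≤ 2 * r - 1 := fun l hl => by
        rcases Nat.lt_or_ge l (k + 1) with hl' | hl'
        · have := hk1 l (by omega); linarith
        obtain rfl : l = k + 1 := by omega
        have h1 := hdisp k (k + 1) (by omega) le_rfl le_rfl
        have h2 := ih (by omega) k le_rfl
        have h3 : ‖y k‖ ≤ ‖y k - y 0‖ + ‖y 0‖ := by simpa using norm_add_le (y k - y 0) (y 0)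
        have h4 : ‖y (k + 1)‖ ≤ ‖y k‖ + ‖disp W WW (s₀ + k * h) (s₀ + (k + 1 : ℕ) * h) (y k)‖ := by
          rw [hy k (by omega)]; exact norm_add_le _ _
        nlinarith
      have hk1M : ((k + 1 : ℕ) : ℝ) * h ≤ M * h := by gcongr
      have hk1a : (((k + 1 : ℕ) : ℝ) * h) ^ α ≤ a := by rw [ha]; gcongr
      have hJ := euler_block_error (M := k + 1) hp hb hc hz hs₀ hh (by linarith)
        (le_trans (by gcongr) hsmall) (fun i hi => hy i (by omega))
        (fun i hi => le_trans (by gcongr) (hk2 i hi)) 0 (k + 1) (by omega) le_rfl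
      have hd0 := hdisp 0 (k + 1) (by omega) le_rfl (by omega)
      -- One factor CGa cancels the sewing constant and the other is at most 1/16, leaving 7 · (1/8)
      -- · (1/16) ≤ 1.
      have hJ2 : sewConst (3 * α) * (7 * C ^ 3 * G ^ 2 * B)
          * ((((k + 1 : ℕ) : ℝ) - (0 : ℕ)) * h) ^ (3 * α) ≤ C * B * a := by
        have hS := sewConst_pos hp
        have hs0 := smallConst_pos hp
        rw [Nat.cast_zero, sub_zero, rpow_three_mul (by positivity)]
        calc _ ≤ sewConst (3 * α) * (7 * C ^ 3 * G ^ 2 * B) * a ^ 3 := by gcongr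
          _ = 7 * (sewConst (3 * α) * (C * G * a)) * (C * G * a) * (C * B * a) := by ring
          _ ≤ 7 * (sewConst (3 * α) * smallConst (3 * α)) * (1 / 16) * (C * B * a) := by gcongr
          _ ≤ 1 * (C * B * a) := by
              rw [sewConst_mul_smallConst hp]
              gcongr; norm_num
          _ = _ := one_mul _
      have e : y (k + 1) - y 0
          = (y (k + 1) - step W WW (s₀ + (0 : ℕ) * h) (s₀ + (k + 1 : ℕ) * h) (y 0))
            + disp W WW (s₀ + (0 : ℕ) * h) (s₀ + (k + 1 : ℕ) * h) (y 0) := by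
        simp only [step]; abel
      rw [e]
      refine (norm_add_le _ _).trans ((add_le_add (hJ.trans hJ2) hd0).trans_eq ?_)
      ring
  exact fun k hk => key k hk k le_rfl

end Block

/-! ### The a priori bound: exponential growth at most. -/

section APriori

variable {V : Type*} [NormedAddCommGroup V]

theorem eul_succ (W : ℝ → V → V) (WW : ℝ → ℝ → V × V → V) (h s : ℝ) (y : V) (k : ℕ) :
    eul W WW h s y (k + 1) = step W WW (s + k * h) (s + (k + 1 : ℕ) * h) (eul W WW h s y k) := by
  rw [eul]; push_cast; rfl

theorem eul_add (W : ℝ → V → V) (WW : ℝ → ℝ → V × V → V) (h s : ℝ) (y : V) (M j : ℕ) :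
    eul W WW h s y (M + j) = eul W WW h (s + M * h) (eul W WW h s y M) j := by
  induction j with
  | zero => rfl
  | succ j ih =>
    rw [← add_assoc, eul_succ, eul_succ, ih]
    congr 1 <;> (push_cast; ring)

variable [NormedSpace ℝ V]

/-- The exponent γ₂ dominates every sum of exponents occurring in the relations: β₁, β₀ + β₂ and
max(β₀,β₁) + max(β₁,β₂). -/
theorem sized_of_growth {β : ℕ → ℝ} (hβ : ∀ k ≤ 3, 0 ≤ β k) {γ₂ : ℝ}
    (hγ₂ : γ₂ = max (β 0) (max (β 1) (β 2)) + max (β 1) (max (β 2) (β 3)) + β 1)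
    {C x : ℝ} (hC : 1 ≤ C) (hx : 1 ≤ x) :
    Sized (fun k => C * x ^ β k) (fun k => C * x ^ (betaStar β k + betaStarStar β k))
      C (x ^ β 0) (x ^ γ₂) := by
  have b0 := hβ 0 (by norm_num)
  have b1 := hβ 1 (by norm_num)
  have b2 := hβ 2 (by norm_num)
  have b3 := hβ 3 (by norm_num)
  have x0 : 0 < x := by linarith
  have u0 := le_max_left (β 0) (max (β 1) (β 2))
  have u1 := (le_max_left (β 1) (β 2)).trans (le_max_right (β 0) (max (β 1) (β 2)))
  have v1 := le_max_left (β 1) (max (β 2) (β 3))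
  have v2 := (le_max_left (β 2) (β 3)).trans (le_max_right (β 1) (max (β 2) (β 3)))
  have s0 : betaStar β 0 + betaStarStar β 0 = β 0 + β 1 := by
    simp [betaStar, betaStarStar]
  have s1 : betaStar β 1 + betaStarStar β 1 = max (β 0) (β 1) + max (β 1) (β 2) := by
    have e (f : ℕ → ℝ) : partialSups f 1 = max (f 0) (f 1) := by
      rw [← zero_add 1, partialSups_add_one, partialSups_zero]
    rw [betaStar, betaStarStar, e, e]
  have w1 : max (β 0) (β 1) ≤ max (β 0) (max (β 1) (β 2)) := by gcongr; exact le_max_left _ _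
  have w2 : max (β 1) (β 2) ≤ max (β 1) (max (β 2) (β 3)) := by gcongr; exact le_max_left _ _
  refine ⟨hC, by positivity, Real.one_le_rpow hx (by linarith), le_rfl, ?_, ?_, ?_, ?_⟩
  · gcongr; linarith
  · rw [mul_assoc, ← Real.rpow_add x0]
    gcongr; linarith
  · rw [mul_assoc, ← Real.rpow_add x0, s0]
    gcongr; linarith
  · simp only [s1]
    gcongr; linarith

/-- The length of the time blocks on which the Euler scheme is controlled from size `r`. -/
noncomputable def blockLen (α C γ₂ r : ℝ) : ℝ :=
  (smallConst (3 * α) / (C * (2 * r) ^ γ₂)) ^ (1 / α)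

variable {T α C γ₂ : ℝ} {β : ℕ → ℝ} {W : ℝ → V → V} {WW : ℝ → ℝ → V × V → V}

theorem blockLen_pos (hp : 1 < 3 * α) (hC : 1 ≤ C) {r : ℝ} (hr : 1 ≤ r) :
    0 < blockLen α C γ₂ r := by
  have := smallConst_pos hp
  unfold blockLen; positivity

theorem blockLen_anti (hp : 1 < 3 * α) (hC : 1 ≤ C) (hγ : 0 ≤ γ₂) {r R : ℝ} (hr : 1 ≤ r)
    (hrR : r ≤ R) : blockLen α C γ₂ R ≤ blockLen α C γ₂ r := by
  have := smallConst_pos hp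
  have : 0 < α := by linarith
  have : 0 ≤ smallConst (3 * α) / (C * (2 * R) ^ γ₂) := by
    have : 0 < R := by linarith
    positivity
  unfold blockLen; gcongr

theorem blockLen_rpow (hp : 1 < 3 * α) (hC : 1 ≤ C) {r : ℝ} (hr : 1 ≤ r) :
    (blockLen α C γ₂ r) ^ α = smallConst (3 * α) / (C * (2 * r) ^ γ₂) := by
  have := smallConst_pos hp
  have : α ≠ 0 := by linarith
  unfold blockLen
  rw [← Real.rpow_mul (by positivity), one_div_mul_cancel this, Real.rpow_one]

/-- The exponential rate in the a priori bound. -/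
noncomputable def growthRate (α C : ℝ) : ℝ :=
  12 * smallConst (3 * α) * (C / smallConst (3 * α)) ^ (1 / α)

/-- The growth hypothesis enters here. The left side is a constant times (2r)^{β₀-γ₂} and the right
side is the same constant times (2r)^{1-γ₂/α}; `growthRate` is normalised to make the constants
agree. Only H/2 is used, because the last grid point of a block may fall short of H. -/
theorem growth_le (hp : 1 < 3 * α) (hC : 1 ≤ C) (hH : γ₂ / α - γ₂ + β 0 ≤ 1) {r : ℝ}
    (hr : 1 ≤ r) :
    3 * C * (2 * r) ^ β 0 * (blockLen α C γ₂ r) ^ α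
      ≤ r * growthRate α C * (blockLen α C γ₂ r / 2) := by
  have hc := smallConst_pos hp
  have hα : 0 < α := by linarith
  rw [blockLen_rpow hp hC hr]
  set c := smallConst (3 * α) with hcdef
  have hx : 1 ≤ 2 * r := by linarith
  have hx0 : 0 < 2 * r := by linarith
  have e1 : blockLen α C γ₂ r * (C / c) ^ (1 / α) = (2 * r) ^ (-(γ₂ / α)) := by
    rw [blockLen, ← hcdef, ← Real.mul_rpow (by positivity) (by positivity)]
    have : c / (C * (2 * r) ^ γ₂) * (C / c) = (2 * r) ^ (-γ₂) := by
      rw [Real.rpow_neg hx0.le]; field_simp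
    rw [this, ← Real.rpow_mul hx0.le]
    congr 1; ring
  have e2 : r * growthRate α C * (blockLen α C γ₂ r / 2)
      = 3 * c * ((2 * r) * (2 * r) ^ (-(γ₂ / α))) := by
    rw [← e1, growthRate, ← hcdef]; ring
  have e3 : 3 * C * (2 * r) ^ β 0 * (c / (C * (2 * r) ^ γ₂))
      = 3 * c * ((2 * r) ^ (β 0 - γ₂)) := by
    rw [Real.rpow_sub hx0]; field_simp
  have e4 : (2 * r) * (2 * r) ^ (-(γ₂ / α)) = (2 * r) ^ (1 - γ₂ / α) := by
    rw [sub_eq_add_neg, Real.rpow_add hx0, Real.rpow_one]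
  rw [e2, e3, e4]
  have := Real.rpow_le_rpow_of_exponent_le hx (by linarith : β 0 - γ₂ ≤ 1 - γ₂ / α)
  gcongr

/-- Strong induction, one block at a time: r becomes r·exp(rate · elapsed time), so the budget
r·exp(rate · remaining time) ≤ R is preserved. Blocks shorten as r grows, but never below `blockLen`
at R, which bounds the mesh. Inside a block the move is at most 1, hence the final 2R. -/
theorem eul_bound_aux (hp : 1 < 3 * α) (hβ : ∀ k ≤ 3, 0 ≤ β k)
    (hγ₂ : γ₂ = max (β 0) (max (β 1) (β 2)) + max (β 1) (max (β 2) (β 3)) + β 1)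
    (hH : γ₂ / α - γ₂ + β 0 ≤ 1) (hC : 1 ≤ C)
    (hb : ∀ ρ, 0 ≤ ρ → BoundsOn T α W WW ρ (fun k => C * (1 + ρ) ^ β k)
      (fun k => C * (1 + ρ) ^ (betaStar β k + betaStarStar β k)))
    (hc : ChenDiag T W WW) {h R : ℝ} (hh : 0 < h) (hhR : h ≤ blockLen α C γ₂ R) :
    ∀ (N : ℕ) (s : ℝ) (y : V) (r : ℝ), 1 ≤ r → 1 + ‖y‖ ≤ r →
      r * Real.exp (growthRate α C * (N * h)) ≤ R → 0 ≤ s → s + N * h ≤ T →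
      ∀ j ≤ N, 1 + ‖eul W WW h s y j‖ ≤ 2 * R := by
  have hα : 0 < α := by linarith
  have hc0 := smallConst_pos hp
  have hc16 := smallConst_le (3 * α)
  have b0 := hβ 0 (by norm_num)
  have b1 := hβ 1 (by norm_num)
  have hγ0 : β 0 ≤ γ₂ := by
    have u0 := le_max_left (β 0) (max (β 1) (β 2))
    have v1 := le_max_left (β 1) (max (β 2) (β 3))
    linarith
  have hrate : 0 ≤ growthRate α C := by unfold growthRate; positivity
  intro N
  induction N using Nat.strong_induction_on with
  | _ N ih =>
    intro s y r hr hy hrR hs hsT j hj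
    have hrR' : r ≤ R := le_trans (le_mul_of_one_le_right (by linarith)
      (Real.one_le_exp (by positivity))) hrR
    set H := blockLen α C γ₂ r with hHdef
    have hH0 : 0 < H := blockLen_pos hp hC hr
    have hhH : h ≤ H := hhR.trans (blockLen_anti hp hC (b0.trans hγ0) hr hrR')
    have hx : 1 ≤ 2 * r := by linarith
    have block : ∀ M : ℕ, M ≤ N → M * h ≤ H → ∀ k ≤ M,
        ‖eul W WW h s y k - y‖ ≤ 3 * C * (2 * r) ^ β 0 * H ^ α := by
      intro M hMN hMH k hk
      have hMa : ((M : ℝ) * h) ^ α ≤ H ^ α := by gcongr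
      have hb' := hb (2 * r - 1) (by linarith)
      rw [show 1 + (2 * r - 1) = 2 * r by ring] at hb'
      have := euler_block_bound (M := M) hp hr hb' hc (sized_of_growth hβ hγ₂ hC hx)
        (Real.rpow_le_rpow_of_exponent_le hx hγ0) hs hh.le
        (le_trans (by gcongr) hsT) (by
          calc C * (2 * r) ^ γ₂ * (M * h) ^ α ≤ C * (2 * r) ^ γ₂ * H ^ α := by gcongr
            _ = smallConst (3 * α) := by
              rw [hHdef, blockLen_rpow hp hC hr]; field_simp)
        (y := eul W WW h s y) hy (fun k _ => eul_succ W WW h s y k) k hk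
      exact this.trans (by gcongr)
    have hsize : 3 * C * (2 * r) ^ β 0 * H ^ α ≤ 1 := by
      rw [hHdef, blockLen_rpow hp hC hr]
      have : (2 * r) ^ β 0 ≤ (2 * r) ^ γ₂ := Real.rpow_le_rpow_of_exponent_le hx hγ0
      calc 3 * C * (2 * r) ^ β 0 * (smallConst (3 * α) / (C * (2 * r) ^ γ₂))
          ≤ 3 * C * (2 * r) ^ γ₂ * (smallConst (3 * α) / (C * (2 * r) ^ γ₂)) := by gcongr
        _ = 3 * smallConst (3 * α) := by field_simp
        _ ≤ 1 := by linarith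
    have tri : ∀ k, ‖eul W WW h s y k‖ ≤ ‖eul W WW h s y k - y‖ + ‖y‖ := fun k => by
      simpa using norm_add_le (eul W WW h s y k - y) y
    set M := ⌊H / h⌋₊ with hM
    have hMH : M * h ≤ H := by
      have := Nat.floor_le (div_pos hH0 hh).le
      calc M * h ≤ H / h * h := by gcongr
        _ = H := by field_simp
    have hM1 : 1 ≤ M := by
      rw [hM, Nat.one_le_floor_iff, one_le_div hh]; exact hhH
    by_cases hjM : j ≤ M
    · have := block j hj (le_trans (by gcongr) hMH) j le_rfl
      have := tri j
      linarith
    · have hMN : M ≤ N := by omega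
      -- (M+1)h > H together with M ≥ 1.
      have hMhalf : H / 2 ≤ M * h := by
        have h1 := Nat.lt_floor_add_one (H / h)
        rw [← hM, div_lt_iff₀ hh] at h1
        have : (1 : ℝ) ≤ M := by exact_mod_cast hM1
        nlinarith
      have hend : 1 + ‖eul W WW h s y M‖ ≤ r * Real.exp (growthRate α C * (M * h)) := by
        have h1 := block M hMN hMH M le_rfl
        have h2 := growth_le hp hC hH hr
        have h3 := tri M
        have h4 := Real.add_one_le_exp (growthRate α C * (M * h))
        calc 1 + ‖eul W WW h s y M‖ ≤ r + r * growthRate α C * (H / 2) := by linarith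
          _ ≤ r + r * growthRate α C * (M * h) := by gcongr
          _ = r * (growthRate α C * (M * h) + 1) := by ring
          _ ≤ _ := by gcongr
      have hcast : ((N - M : ℕ) : ℝ) = N - M := Nat.cast_sub hMN
      have e1 : s + M * h + ((N - M : ℕ) : ℝ) * h = s + N * h := by rw [hcast]; ring
      have hr' : 1 ≤ r * Real.exp (growthRate α C * (M * h)) :=
        le_trans (by have := norm_nonneg (eul W WW h s y M); linarith) hend
      have := ih (N - M) (by omega) (s + M * h) (eul W WW h s y M) _ hr' hend (by
        rw [mul_assoc, ← Real.exp_add, ← mul_add, ← add_mul, hcast, add_sub_cancel]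
        exact hrR) (by positivity) (e1.trans_le hsT) (j - M) (by omega)
      rwa [← eul_add, show M + (j - M) = j by omega] at this

/-- A priori bound for the Euler schemes, uniform in the mesh. -/
theorem exists_eul_bound (hp : 1 < 3 * α) (hβ : ∀ k ≤ 3, 0 ≤ β k)
    (hγ₂ : γ₂ = max (β 0) (max (β 1) (β 2)) + max (β 1) (max (β 2) (β 3)) + β 1)
    (hH : γ₂ / α - γ₂ + β 0 ≤ 1) (hC : 1 ≤ C)
    (hb : ∀ ρ, 0 ≤ ρ → BoundsOn T α W WW ρ (fun k => C * (1 + ρ) ^ β k)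
      (fun k => C * (1 + ρ) ^ (betaStar β k + betaStarStar β k)))
    (hc : ChenDiag T W WW) (ρ : ℝ) (hρ : 0 ≤ ρ) :
    ∃ R h₀ : ℝ, 0 ≤ R ∧ 0 < h₀ ∧ ∀ h, 0 < h → h ≤ h₀ → ∀ s, 0 ≤ s → ∀ y, ‖y‖ ≤ ρ → ∀ N : ℕ,
      s + N * h ≤ T → ‖eul W WW h s y N‖ ≤ R := by
  have hα : 0 < α := by linarith
  have hc0 := smallConst_pos hp
  have hrate : 0 ≤ growthRate α C := by unfold growthRate; positivity
  set R := (1 + ρ) * Real.exp (growthRate α C * |T|) with hR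
  have hR1 : 1 ≤ R := one_le_mul_of_one_le_of_one_le (by linarith)
    (Real.one_le_exp (by positivity))
  refine ⟨2 * R, blockLen α C γ₂ R, by linarith, blockLen_pos hp hC hR1,
    fun h hh hhR s hs y hy N hN => ?_⟩
  have := eul_bound_aux hp hβ hγ₂ hH hC hb hc hh hhR N s y (1 + ρ) (by linarith) (by linarith) (by
    rw [hR]
    gcongr
    exact le_trans (by linarith) (le_abs_self T)) hs hN N le_rfl
  linarith

end APriori

/-! ### Mesh-uniform Lipschitz dependence on the starting point. -/

section Lipschitz

variable {V : Type*} [NormedAddCommGroup V] [NormedSpace ℝ V] {T α ρ K : ℝ} {W : ℝ → V → V}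
  {WW : ℝ → ℝ → V × V → V}

theorem BoundsOn.mono {m n m' n' : ℕ → ℝ} (h : BoundsOn T α W WW ρ m n)
    (hm : ∀ k ≤ 3, m k ≤ m' k) (hn : ∀ k ≤ 2, n k ≤ n' k) (hm' : ∀ k, 0 ≤ m' k)
    (hn' : ∀ k, 0 ≤ n' k) : BoundsOn T α W WW ρ m' n' where
  diff_inc := h.diff_inc
  diff_inc' := h.diff_inc'
  diff_inc'' := h.diff_inc''
  diff_dia := h.diff_dia
  nonneg := hm'
  nonneg' := hn'
  inc_le s hs t ht x hx := (h.inc_le s hs t ht x hx).trans (by gcongr; exact hm 0 (by norm_num))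
  inc'_le s hs t ht x hx := (h.inc'_le s hs t ht x hx).trans (by gcongr; exact hm 1 (by norm_num))
  inc''_le s hs t ht x hx :=
    (h.inc''_le s hs t ht x hx).trans (by gcongr; exact hm 2 (by norm_num))
  inc'''_le s hs t ht x hx :=
    (h.inc'''_le s hs t ht x hx).trans (by gcongr; exact hm 3 (by norm_num))
  dia_le s hs t ht x hx := (h.dia_le s hs t ht x hx).trans (by gcongr; exact hn 0 (by norm_num))
  dia'_le s hs t ht x hx := (h.dia'_le s hs t ht x hx).trans (by gcongr; exact hn 1 (by norm_num))
  dia'_lip s hs t ht x y hx hy :=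
    (h.dia'_lip s hs t ht x y hx hy).trans (by gcongr; exact hn 2 (by norm_num))

/-- On every ball, `W` and `𝕎` and their derivatives are bounded by a single constant. -/
def LocallyBounded (T α : ℝ) (W : ℝ → V → V) (WW : ℝ → ℝ → V × V → V) : Prop :=
  ∀ ρ, 0 ≤ ρ → ∃ K : ℝ, 1 ≤ K ∧ BoundsOn T α W WW ρ (fun _ => K) (fun _ => K)

omit [NormedSpace ℝ V] in
/-- The Euler schemes started in a ball stay in a ball, uniformly in the mesh. -/
def EulerBounded (T : ℝ) (W : ℝ → V → V) (WW : ℝ → ℝ → V × V → V) : Prop :=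
  ∀ ρ, 0 ≤ ρ → ∃ R h₀ : ℝ, 0 ≤ R ∧ 0 < h₀ ∧ ∀ h, 0 < h → h ≤ h₀ → ∀ s, 0 ≤ s → ∀ y, ‖y‖ ≤ ρ →
    ∀ N : ℕ, s + N * h ≤ T → ‖eul W WW h s y N‖ ≤ R

/-- From here on the growth exponents play no role: a single constant per ball is enough. -/
theorem locallyBounded_of_growth {C : ℝ} {β : ℕ → ℝ} (hC : 1 ≤ C)
    (hb : ∀ ρ, 0 ≤ ρ → BoundsOn T α W WW ρ (fun k => C * (1 + ρ) ^ β k)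
      (fun k => C * (1 + ρ) ^ (betaStar β k + betaStarStar β k))) : LocallyBounded T α W WW := by
  intro ρ hρ
  set f : ℕ → ℝ := fun k => C * (1 + ρ) ^ β k
  set g : ℕ → ℝ := fun k => C * (1 + ρ) ^ (betaStar β k + betaStarStar β k)
  have hf : ∀ k, 0 ≤ f k := fun k => by positivity
  have hg : ∀ k, 0 ≤ g k := fun k => by positivity
  set K := 1 + ∑ k ∈ Finset.range 4, f k + ∑ k ∈ Finset.range 4, g k
  have h1 : 0 ≤ ∑ k ∈ Finset.range 4, f k := Finset.sum_nonneg fun k _ => hf k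
  have h2 : 0 ≤ ∑ k ∈ Finset.range 4, g k := Finset.sum_nonneg fun k _ => hg k
  have hK : 1 ≤ K := by linarith
  refine ⟨K, hK, (hb ρ hρ).mono (fun k hk => ?_) (fun k hk => ?_) (fun _ => by linarith)
    (fun _ => by linarith)⟩
  · have := Finset.single_le_sum (f := f) (fun k _ => hf k) (Finset.mem_range.2 (by omega : k < 4))
    change f k ≤ K
    linarith
  · have := Finset.single_le_sum (f := g) (fun k _ => hg k) (Finset.mem_range.2 (by omega : k < 4))
    change g k ≤ K
    linarith

theorem sized_const (hK : 1 ≤ K) : Sized (fun _ => K) (fun _ => K) K 1 1 :=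
  ⟨hK, zero_le_one, le_rfl, by simp, by simp, by simp, by simp, by simp⟩

/-- The constant in the one-step error over a block. -/
noncomputable def errConst (α K : ℝ) : ℝ := sewConst (3 * α) * (7 * K ^ 3)

theorem errConst_nonneg (hp : 1 < 3 * α) (hK : 1 ≤ K) : 0 ≤ errConst α K := by
  have := sewConst_pos hp
  unfold errConst; positivity

/-- Two Euler schemes diverge by at most a factor `2` over a short block. -/
theorem euler_block_lip (hp : 1 < 3 * α) (hK : 1 ≤ K)
    (hb : BoundsOn T α W WW ρ (fun _ => K) (fun _ => K))
    (hc : ChenDiag T W WW) {s₀ h : ℝ} {M : ℕ} (hs₀ : 0 ≤ s₀)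
    (hh : 0 ≤ h) (hT : s₀ + M * h ≤ T) (hsmall : K * (M * h) ^ α ≤ smallConst (3 * α))
    (hsmall' : sewConst (3 * α) * (26 * K ^ 3 + errConst α K) * ((M * h) ^ α) ^ 3 ≤ 1 / 4)
    {y z : ℕ → V} (hy : ∀ k < M, y (k + 1) = step W WW (s₀ + k * h) (s₀ + (k + 1 : ℕ) * h) (y k))
    (hz : ∀ k < M, z (k + 1) = step W WW (s₀ + k * h) (s₀ + (k + 1 : ℕ) * h) (z k))
    (hyb : ∀ k ≤ M, ‖y k‖ + 2 * K * (M * h) ^ α ≤ ρ)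
    (hzb : ∀ k ≤ M, ‖z k‖ + 2 * K * (M * h) ^ α ≤ ρ) :
    ∀ k ≤ M, ‖y k - z k‖ ≤ 2 * ‖y 0 - z 0‖ := by
  have hα : 0 ≤ α := by linarith
  have hS := sewConst_pos hp
  have hsz := sized_const hK
  have hL := errConst_nonneg hp hK
  have Jy := euler_block_error hp hb hc hsz hs₀ hh hT (by simpa using hsmall) hy
    (by simpa using hyb)
  have Jz := euler_block_error hp hb hc hsz hs₀ hh hT (by simpa using hsmall) hz
    (by simpa using hzb)
  simp only [one_pow, mul_one] at Jy Jz
  rw [← errConst] at Jy Jz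
  set L := errConst α K with hLdef
  set a := ((M : ℝ) * h) ^ α with ha
  have ha0 : 0 ≤ a := by positivity
  have hs16 : K * a ≤ 1 / 16 := hsmall.trans (smallConst_le _)
  have hs16' : K * 1 * a ≤ 1 / 16 := by simpa using hs16
  have hmem : ∀ k ≤ M, s₀ + k * h ∈ Icc 0 T := fun k hk => grid_mem hs₀ hh hT hk
  have hball : ∀ {y : ℕ → V}, (∀ k ≤ M, ‖y k‖ + 2 * K * a ≤ ρ) → (∀ k ≤ M, ‖y k‖ ≤ ρ) ∧
      ∀ i j, i ≤ j → j ≤ M → ‖step W WW (s₀ + i * h) (s₀ + j * h) (y i)‖ ≤ ρ := by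
    intro y hyb
    have h1 : ∀ k ≤ M, ‖y k‖ ≤ ρ := fun k hk => by
      have := hyb k hk
      have : 0 ≤ 2 * K * a := by positivity
      linarith
    refine ⟨h1, fun i j hij hj => (norm_add_le _ _).trans
      ((add_le_add le_rfl ?_).trans (hyb i (hij.trans hj)))⟩
    have := hsz.disp_size ha0 hs16'
    rw [mul_one] at this
    exact (hb.disp_le (hmem i (hij.trans hj)) (hmem j hj)
      (grid_abs_rpow_le hα hh hij (by omega)) (h1 i (hij.trans hj))).trans this
  obtain ⟨hyρ, hyst⟩ := hball hyb
  obtain ⟨hzρ, hzst⟩ := hball hzb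
  -- The largest distance Δ on the block controls all base-point differences. It is absorbed at the
  -- end through Δ ≤ (9/8)‖y₀ - z₀‖ + Δ/4.
  obtain ⟨k₀, hk₀, hmax⟩ := Finset.exists_max_image (Finset.range (M + 1))
    (fun k => ‖y k - z k‖) ⟨0, by simp⟩
  set Δ := ‖y k₀ - z k₀‖ with hΔ
  have hΔ0 : 0 ≤ Δ := norm_nonneg _
  have hle : ∀ k ≤ M, ‖y k - z k‖ ≤ Δ := fun k hk => hmax k (Finset.mem_range.2 (by omega))
  -- Sewing is applied to the difference of the two one-step errors. In κ, 26K³Δ comes from the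
  -- difference of defects and LΔ from carrying the errors through a step at different base points.
  have hD := discrete_sewing hp (ε := 2 * (K * a)) (κ := (26 * K ^ 3 + L) * Δ) (h := h) (m := M)
    (A := fun i j => ‖(y j - step W WW (s₀ + i * h) (s₀ + j * h) (y i))
      - (z j - step W WW (s₀ + i * h) (s₀ + j * h) (z i))‖) (by positivity)
    (smallConst_ratio hp (by linarith)) (by positivity) hh
    (fun i hi => by simp only [hy i hi, hz i hi, sub_self, norm_zero, le_refl]) (by
      intro i j k hij hjk hk
      set b := (((k : ℝ) - i) * h) ^ α with hbdef
      have hki : (0 : ℝ) ≤ (k : ℝ) - i := sub_nonneg.2 (by exact_mod_cast (hij.trans hjk).le)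
      have hkih : 0 ≤ ((k : ℝ) - i) * h := by positivity
      have hb0 : 0 ≤ b := by positivity
      have hcast : (((k - i : ℕ) : ℝ)) = (k : ℝ) - i := Nat.cast_sub (hij.trans hjk).le
      have hba : b ≤ a := by
        have : (k : ℝ) ≤ M := by exact_mod_cast hk
        have : (0 : ℝ) ≤ i := by positivity
        rw [hbdef, ha]; gcongr; linarith
      have hbs16 : K * b ≤ 1 / 16 := le_trans (by gcongr) hs16
      have hbs16' : K * 1 * b ≤ 1 / 16 := by simpa using hbs16
      have r1 : |s₀ + j * h - (s₀ + i * h)| ^ α ≤ b := by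
        rw [hbdef, ← hcast]; exact grid_abs_rpow_le hα hh hij.le (by omega)
      have r2 : |s₀ + k * h - (s₀ + j * h)| ^ α ≤ b := by
        rw [hbdef, ← hcast]; exact grid_abs_rpow_le hα hh hjk.le (by omega)
      have mi := hmem i (by omega)
      have mj := hmem j (by omega)
      have mk := hmem k hk
      have hlip : K * b + K * b ^ 2 ≤ 2 * (K * b) := by
        simpa using hsz.lip_size hb0 hbs16'
      have hlipa : K * a + K * a ^ 2 ≤ 2 * (K * a) := by
        simpa using hsz.lip_size ha0 hs16'
      have hdisp : K * b + K * b ^ 2 ≤ 2 * K * b := by linarith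
      have yi := hyρ i (by omega)
      have zi := hzρ i (by omega)
      have yij := hyst i j hij.le (by omega)
      have zij := hzst i j hij.le (by omega)
      have Δi := hle i (by omega)
      have hst : ‖step W WW (s₀ + i * h) (s₀ + j * h) (y i)
          - step W WW (s₀ + i * h) (s₀ + j * h) (z i)‖ ≤ 2 * Δ := by
        refine (hb.step_lip mi mj r1 yi zi).trans ?_
        gcongr
        linarith
      have hη : ‖disp W WW (s₀ + i * h) (s₀ + j * h) (y i)
          - disp W WW (s₀ + i * h) (s₀ + j * h) (z i)‖ ≤ 2 * K * b * Δ := by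
        refine (hb.disp_lip mi mj r1 yi zi).trans ?_
        gcongr
      have d1 := hb.defect_lip mi mj r1 mk r2 hc yi yij zi zij (Δi.trans (by linarith)) hst hη
        ((hb.disp_le mi mj r1 yi).trans hdisp) ((hb.disp_le mi mj r1 zi).trans hdisp)
      -- The terms sum to 16K³ + 10K², at most 26K³ since K ≥ 1.
      have d1' : (K * b * (2 * K * b * Δ) + K * b * (2 * Δ) * (2 * K * b)) * (2 * K * b)
          + K * b * (2 * K * b) * (2 * K * b * Δ)
          + (K * b * (K * b ^ 2 * (2 * Δ)) + K * b * (2 * Δ) * (K * b ^ 2))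
          + (K * b ^ 2 * (2 * K * b * Δ) + K * b ^ 2 * (2 * Δ) * (2 * K * b))
          ≤ 26 * K ^ 3 * Δ * b ^ 3 := by
        have : K ^ 2 * (Δ * b ^ 3) ≤ K ^ 3 * (Δ * b ^ 3) := by
          gcongr
          · norm_num
        linarith
      have hJ : ‖y j - step W WW (s₀ + i * h) (s₀ + j * h) (y i)‖ ≤ L * b ^ 3 := by
        refine (Jy i j hij (by omega)).trans ?_
        have hji : (0 : ℝ) ≤ (j : ℝ) - i := sub_nonneg.2 (by exact_mod_cast hij.le)
        have hjk' : (j : ℝ) ≤ k := by exact_mod_cast hjk.le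
        rw [← rpow_three_mul hkih]
        gcongr
      rw [rpow_three_mul hkih]
      set P := step W WW (s₀ + i * h) (s₀ + j * h) (y i)
      set Q := step W WW (s₀ + i * h) (s₀ + j * h) (z i)
      -- The increments are the one-step errors themselves, so ‖v‖ is already of order b³.
      have d2 := hb.disp_four_point mj mk r2 (y := P) (z := Q) (v := y j - P) (w := z j - Q)
        (δ := 2 * Δ) yij zij (by simpa using hyρ j (by omega)) (by simpa using hzρ j (by omega))
        hst (by simpa using (hle j (by omega)).trans (by linarith))
      rw [add_sub_cancel, add_sub_cancel] at d2
      have d3 : (K * b + K * b ^ 2) * ‖y j - P - (z j - Q)‖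
          + (K * b + K * b ^ 2) * (2 * Δ) * ‖y j - P‖
          ≤ 2 * (K * a) * ‖y j - P - (z j - Q)‖ + L * Δ * b ^ 3 := by
        gcongr ?_ * _ + ?_
        · exact hlip.trans (by gcongr)
        · calc (K * b + K * b ^ 2) * (2 * Δ) * ‖y j - P‖
              ≤ (1 / 8) * (2 * Δ) * (L * b ^ 3) := by gcongr; linarith
            _ ≤ L * Δ * b ^ 3 := by
              have : 0 ≤ L * Δ * b ^ 3 := by positivity
              linarith
      have e : (y k - step W WW (s₀ + i * h) (s₀ + k * h) (y i))
          - (z k - step W WW (s₀ + i * h) (s₀ + k * h) (z i))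
          = ((y k - step W WW (s₀ + j * h) (s₀ + k * h) (y j))
              - (z k - step W WW (s₀ + j * h) (s₀ + k * h) (z j)))
            + (y j - P - (z j - Q))
            + (disp W WW (s₀ + j * h) (s₀ + k * h) (y j) - disp W WW (s₀ + j * h) (s₀ + k * h) P
              - (disp W WW (s₀ + j * h) (s₀ + k * h) (z j)
                - disp W WW (s₀ + j * h) (s₀ + k * h) Q))
            + (step W WW (s₀ + j * h) (s₀ + k * h) P - step W WW (s₀ + i * h) (s₀ + k * h) (y i)
              - (step W WW (s₀ + j * h) (s₀ + k * h) Q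
                - step W WW (s₀ + i * h) (s₀ + k * h) (z i))) := by
        have e1 : ∀ x, step W WW (s₀ + j * h) (s₀ + k * h) x
          = x + disp W WW (s₀ + j * h) (s₀ + k * h) x := fun _ => rfl
        rw [e1, e1, e1, e1]; abel
      rw [e]
      refine (norm_add₄_le).trans ?_
      have := d1.trans d1'
      have := d2.trans d3
      linarith)
  have hfin : ∀ k ≤ M, ‖y k - z k‖ ≤ 9 / 8 * ‖y 0 - z 0‖ + 1 / 4 * Δ := by
    intro k hk
    rcases Nat.eq_zero_or_pos k with rfl | hk0
    · have := norm_nonneg (y 0 - z 0)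
      linarith
    have h1 := hD 0 k hk0 hk
    have hkM : (k : ℝ) ≤ M := by exact_mod_cast hk
    have h2 : sewConst (3 * α) * ((26 * K ^ 3 + L) * Δ) * (((k : ℝ) - (0 : ℕ)) * h) ^ (3 * α)
        ≤ 1 / 4 * Δ := by
      rw [Nat.cast_zero, sub_zero, rpow_three_mul (by positivity)]
      calc _ ≤ sewConst (3 * α) * ((26 * K ^ 3 + L) * Δ) * a ^ 3 := by rw [ha]; gcongr
        _ = sewConst (3 * α) * (26 * K ^ 3 + L) * a ^ 3 * Δ := by ring
        _ ≤ _ := by gcongr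
    have h3 := hb.step_lip (hmem 0 (by omega)) (hmem k hk)
      (grid_abs_rpow_le hα hh (M := M) (by omega) (by omega)) (hyρ 0 (by omega)) (hzρ 0 (by omega))
    have h4 : 1 + (K * a + K * a ^ 2) ≤ 9 / 8 := by
      have := hsz.lip_size ha0 hs16'
      linarith
    have e : y k - z k = (step W WW (s₀ + (0 : ℕ) * h) (s₀ + k * h) (y 0)
        - step W WW (s₀ + (0 : ℕ) * h) (s₀ + k * h) (z 0))
        + ((y k - step W WW (s₀ + (0 : ℕ) * h) (s₀ + k * h) (y 0))
          - (z k - step W WW (s₀ + (0 : ℕ) * h) (s₀ + k * h) (z 0))) := by abel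
    rw [e]
    exact (norm_add_le _ _).trans (add_le_add (h3.trans (by gcongr)) (h1.trans h2))
  have hΔf := hfin k₀ (by simpa [Nat.lt_succ_iff] using hk₀)
  intro k hk
  have := hle k hk
  have := norm_nonneg (y 0 - z 0)
  linarith

/-- A time length on which the smallness conditions of a block hold. -/
theorem exists_small_time (hp : 1 < 3 * α) (hK : 1 ≤ K) : ∃ τ : ℝ, 0 < τ ∧ ∀ x, 0 ≤ x → x ≤ τ →
    K * x ^ α ≤ smallConst (3 * α) ∧
      sewConst (3 * α) * (26 * K ^ 3 + errConst α K) * (x ^ α) ^ 3 ≤ 1 / 4 := by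
  have hα : 0 < α := by linarith
  have hS := sewConst_pos hp
  have hs := smallConst_pos hp
  have hs1 := smallConst_le (3 * α)
  have hL := errConst_nonneg hp hK
  set Q := sewConst (3 * α) * (26 * K ^ 3 + errConst α K) with hQ
  have hQ0 : 0 < Q := by positivity
  set a := min (smallConst (3 * α) / K) (1 / (4 * Q)) with ha
  have ha0 : 0 < a := by positivity
  refine ⟨a ^ (1 / α), by positivity, fun x hx0 hx => ?_⟩
  have hxa : x ^ α ≤ a := by
    calc x ^ α ≤ (a ^ (1 / α)) ^ α := by gcongr
      _ = a := by rw [← Real.rpow_mul ha0.le, one_div_mul_cancel hα.ne', Real.rpow_one]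
  have h1 : K * x ^ α ≤ smallConst (3 * α) := by
    have := hxa.trans (min_le_left _ _)
    rwa [le_div_iff₀ (by linarith), mul_comm] at this
  refine ⟨h1, ?_⟩
  have hx1 : x ^ α ≤ 1 := by
    have : 0 ≤ x ^ α := by positivity
    nlinarith
  have h2 : (x ^ α) ^ 3 ≤ x ^ α := pow_le_of_le_one (by positivity) hx1 (by norm_num)
  have h3 := hxa.trans (min_le_right _ _)
  rw [le_div_iff₀ (by positivity)] at h3
  calc Q * (x ^ α) ^ 3 ≤ Q * x ^ α := by gcongr
    _ ≤ 1 / 4 := by linarith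

/-- The Euler schemes are Lipschitz in the starting point, uniformly in the mesh. -/
theorem exists_eul_lip (hp : 1 < 3 * α) (hlb : LocallyBounded T α W WW)
    (hc : ChenDiag T W WW) (heb : EulerBounded T W WW) (hρ : 0 ≤ ρ) :
    ∃ Λ h₀ : ℝ, 0 ≤ Λ ∧ 0 < h₀ ∧ ∀ h, 0 < h → h ≤ h₀ → ∀ s, 0 ≤ s → ∀ y z, ‖y‖ ≤ ρ → ‖z‖ ≤ ρ →
      ∀ N : ℕ, s + N * h ≤ T → ‖eul W WW h s y N - eul W WW h s z N‖ ≤ Λ * ‖y - z‖ := by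
  obtain ⟨R, h₁, hR, hh₁, HR⟩ := heb ρ hρ
  obtain ⟨K, hK, hb⟩ := hlb (R + 1) (by linarith)
  obtain ⟨τ, hτ, Hτ⟩ := exists_small_time (α := α) hp hK
  -- Each block at most doubles the distance and lasts at least τ/2, so ⌈2T/τ⌉ blocks cover the time
  -- interval. The a priori bound provides the same `K` on every block.
  refine ⟨2 ^ ⌈2 * T / τ⌉₊, min h₁ τ, by positivity, lt_min hh₁ hτ,
    fun h hh hhm s hs y z hy hz N hN => ?_⟩
  have hhτ : h ≤ τ := hhm.trans (min_le_right _ _)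
  have HR' := HR h hh (hhm.trans (min_le_left _ _)) s hs
  set M := ⌊τ / h⌋₊ with hM
  have hMτ : M * h ≤ τ := by
    have := Nat.floor_le (div_pos hτ hh).le
    calc M * h ≤ τ / h * h := by gcongr
      _ = τ := by field_simp
  have hM1 : 1 ≤ M := by
    rw [hM, Nat.one_le_floor_iff, one_le_div hh]; exact hhτ
  have key : ∀ q n : ℕ, n ≤ q * M → n ≤ N →
      ‖eul W WW h s y n - eul W WW h s z n‖ ≤ 2 ^ q * ‖y - z‖ := by
    intro q
    induction q with
    | zero =>
      intro n hn _
      obtain rfl : n = 0 := by omega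
      simp [eul]
    | succ q ih =>
      intro n hn hnN
      have h2 : (2 : ℝ) ^ (q + 1) = 2 * 2 ^ q := by ring
      rcases le_total n (q * M) with hq | hq
      · refine (ih n hq hnN).trans ?_
        gcongr
        · norm_num
        · omega
      · obtain ⟨j, rfl⟩ := Nat.exists_eq_add_of_le hq
        have hjM : j ≤ M := by rw [add_mul] at hn; omega
        have hjτ : (j : ℝ) * h ≤ τ := le_trans (by gcongr) hMτ
        have hsm := Hτ (j * h) (by positivity) hjτ
        have hT' : s + (q * M : ℕ) * h + j * h ≤ T := by
          refine le_trans ?_ hN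
          have : ((q * M + j : ℕ) : ℝ) ≤ N := by exact_mod_cast hnN
          push_cast at this ⊢
          nlinarith
        have hs16 := hsm.1.trans (smallConst_le _)
        have hbd : ∀ x, ‖x‖ ≤ ρ → ∀ k ≤ j,
            ‖eul W WW h (s + (q * M : ℕ) * h) (eul W WW h s x (q * M)) k‖
              + 2 * K * (j * h) ^ α ≤ R + 1 := by
          intro x hx k hk
          rw [← eul_add]
          have := HR' x hx (q * M + k) (by
            refine le_trans ?_ hN
            have : q * M + k ≤ N := by omega
            gcongr)
          linarith
        rw [eul_add, eul_add, h2, mul_assoc]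
        refine (euler_block_lip hp hK hb hc (M := j) (by positivity) hh.le hT' hsm.1 hsm.2
          (fun k _ => eul_succ ..) (fun k _ => eul_succ ..) (hbd y hy) (hbd z hz) j le_rfl).trans ?_
        gcongr
        exact ih (q * M) le_rfl (by omega)
  refine key _ N ?_ le_rfl
  have h1 := Nat.lt_floor_add_one (τ / h)
  rw [← hM, div_lt_iff₀ hh] at h1
  have hM1' : (1 : ℝ) ≤ M := by exact_mod_cast hM1
  have h2 : τ ≤ 2 * (M * h) := by nlinarith
  have h3 := Nat.le_ceil (2 * T / τ)
  set q := ⌈2 * T / τ⌉₊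
  rw [div_le_iff₀ hτ] at h3
  have h4 : (N : ℝ) * h ≤ q * M * h := by
    have : (q : ℝ) * τ ≤ q * (2 * (M * h)) := by gcongr
    linarith
  exact_mod_cast le_of_mul_le_mul_right h4 hh

/-- Over short times the Euler schemes are close to a single step, uniformly in the mesh. -/
theorem exists_eul_error (hp : 1 < 3 * α) (hlb : LocallyBounded T α W WW)
    (hc : ChenDiag T W WW) (heb : EulerBounded T W WW) (hρ : 0 ≤ ρ) :
    ∃ L τ h₀ : ℝ, 0 ≤ L ∧ 0 < τ ∧ 0 < h₀ ∧ ∀ h, 0 < h → h ≤ h₀ → ∀ s, 0 ≤ s → ∀ y, ‖y‖ ≤ ρ →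
      ∀ N : ℕ, s + N * h ≤ T → N * h ≤ τ →
        ‖eul W WW h s y N - step W WW s (s + N * h) y‖ ≤ L * (N * h) ^ (3 * α) := by
  obtain ⟨R, h₁, hR, hh₁, HR⟩ := heb ρ hρ
  obtain ⟨K, hK, hb⟩ := hlb (R + 1) (by linarith)
  obtain ⟨τ, hτ, Hτ⟩ := exists_small_time (α := α) hp hK
  refine ⟨errConst α K, τ, h₁, errConst_nonneg hp hK, hτ, hh₁,
    fun h hh hhm s hs y hy N hN hNτ => ?_⟩
  have hsm := Hτ (N * h) (by positivity) hNτ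
  have hs16 := hsm.1.trans (smallConst_le _)
  have hbd : ∀ k ≤ N, ‖eul W WW h s y k‖ + 2 * K * 1 * (N * h) ^ α ≤ R + 1 := by
    intro k hk
    have := HR h hh hhm s hs y hy k (le_trans (by gcongr) hN)
    linarith
  rcases Nat.eq_zero_or_pos N with rfl | hN0
  · have e : step W WW s s y = y := by
      have h1 := hc s ⟨hs, by simpa using hN⟩ s ⟨hs, by simpa using hN⟩ s ⟨hs, by simpa using hN⟩ y
      have h2 : inc W s s y = 0 := by simp [inc]
      rw [h2, map_zero, add_zero] at h1
      have h3 : dia WW s s y = 0 := by simpa using h1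
      simp [step, disp, h2, h3]
    have : (3 * α) ≠ 0 := by linarith
    simp [eul, e, Real.zero_rpow this]
  · have := euler_block_error hp hb hc (sized_const hK) hs hh.le hN (by simpa using hsm.1)
      (fun k _ => eul_succ W WW h s y k) hbd 0 N hN0 le_rfl
    simpa [errConst, eul] using this

end Lipschitz

/-! ### Telescoping and convergence of the schemes. -/

section Limit

variable {V : Type*} [NormedAddCommGroup V] {T α ρ : ℝ} {W : ℝ → V → V}
  {WW : ℝ → ℝ → V × V → V}

theorem eul_add_one_left (W : ℝ → V → V) (WW : ℝ → ℝ → V × V → V) (h s : ℝ) (y : V) (i j : ℕ) :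
    eul W WW h (s + i * h) y (j + 1) = eul W WW h (s + (i + 1 : ℕ) * h)
      (step W WW (s + i * h) (s + (i + 1 : ℕ) * h) y) j := by
  rw [add_comm j 1, eul_add, eul_succ, eul]
  congr 1
  · push_cast; ring
  · congr 1 <;> (push_cast; ring)

/-- A sequence that satisfies the Euler recursion up to errors `η` stays close to the scheme. -/
theorem norm_sub_eul_le {Λ h s η : ℝ} {N : ℕ} (hh : 0 ≤ h) (hs : 0 ≤ s) (hsT : s + N * h ≤ T)
    (hΛ0 : 0 ≤ Λ)
    (hΛ : ∀ s, 0 ≤ s → ∀ y z, ‖y‖ ≤ ρ → ‖z‖ ≤ ρ → ∀ N : ℕ, s + N * h ≤ T →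
      ‖eul W WW h s y N - eul W WW h s z N‖ ≤ Λ * ‖y - z‖) {x : ℕ → V}
    (hx : ∀ k ≤ N, ‖x k‖ ≤ ρ)
    (hx' : ∀ k < N, ‖step W WW (s + k * h) (s + (k + 1 : ℕ) * h) (x k)‖ ≤ ρ)
    (herr : ∀ k < N, ‖x (k + 1) - step W WW (s + k * h) (s + (k + 1 : ℕ) * h) (x k)‖ ≤ η) :
    ‖x N - eul W WW h s (x 0) N‖ ≤ N * (Λ * η) := by
  -- The exact scheme is restarted from x i for the remaining N - i steps. Passing from i to i + 1
  -- costs one local error, propagated with factor Λ.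
  have key : ∀ i ≤ N, ‖eul W WW h (s + i * h) (x i) (N - i) - eul W WW h s (x 0) N‖
      ≤ i * (Λ * η) := by
    intro i
    induction i with
    | zero => intro _; simp
    | succ i ih =>
      intro hi
      obtain ⟨j, hj⟩ : ∃ j, N - i = j + 1 := ⟨N - i - 1, by omega⟩
      have h1 := ih (by omega)
      rw [hj, eul_add_one_left] at h1
      have h2 := hΛ (s + (i + 1 : ℕ) * h) (by positivity) (x (i + 1)) _ (hx _ hi)
        (hx' i (by omega)) j (by
          refine le_trans (le_of_eq ?_) hsT
          have : N = i + 1 + j := by omega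
          rw [this]; push_cast; ring)
      have h3 : Λ * ‖x (i + 1) - step W WW (s + i * h) (s + (i + 1 : ℕ) * h) (x i)‖ ≤ Λ * η := by
        gcongr; exact herr i (by omega)
      rw [show N - (i + 1) = j by omega]
      refine (norm_sub_le_norm_sub_add_norm_sub _ _ _).trans ((add_le_add (h2.trans h3) h1).trans ?_)
      push_cast
      linarith
  have := key N le_rfl
  rwa [Nat.sub_self, eul] at this

variable [NormedSpace ℝ V]

theorem disp_le_const {K : ℝ} (hb : BoundsOn T α W WW ρ (fun _ => K) (fun _ => K)) (hα : 0 ≤ α)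
    {s t h : ℝ} (hs : s ∈ Icc 0 T) (ht : t ∈ Icc 0 T) (hst : |t - s| ≤ h)
    (hh1 : h ≤ 1) {x : V} (hx : ‖x‖ ≤ ρ) : ‖disp W WW s t x‖ ≤ 2 * K * h ^ α := by
  have hh : 0 ≤ h := (abs_nonneg _).trans hst
  have h1 : |t - s| ^ α ≤ h ^ α := by gcongr
  have h2 : 0 ≤ h ^ α := by positivity
  have h3 : h ^ α ≤ 1 := Real.rpow_le_one hh hh1 hα
  have hK : 0 ≤ K := hb.nonneg 0
  refine (hb.disp_le hs ht h1 hx).trans ?_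
  have : K * (h ^ α) ^ 2 ≤ K * h ^ α := by
    gcongr; exact pow_le_of_le_one h2 h3 (by norm_num)
  linarith

theorem mul_rpow_three_le {h : ℝ} {N : ℕ} (hh : 0 < h) (hN : N * h ≤ T) :
    N * h ^ (3 * α) ≤ T * h ^ (3 * α - 1) := by
  rw [Real.rpow_sub_one hh.ne']
  calc N * h ^ (3 * α) = N * h * (h ^ (3 * α) / h) := by field_simp
    _ ≤ _ := by gcongr

/-- Comparison of the Euler schemes of mesh `h` and `h / 2`. -/
theorem exists_refine (hp : 1 < 3 * α) (hlb : LocallyBounded T α W WW)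
    (hc : ChenDiag T W WW) (heb : EulerBounded T W WW) (ξ : V) :
    ∃ A h₀ : ℝ, 0 ≤ A ∧ 0 < h₀ ∧ ∀ h, 0 < h → h ≤ h₀ →
      (∀ k : ℕ, k * h ≤ T →
        ‖eul W WW (h / 2) 0 ξ (2 * k) - eul W WW h 0 ξ k‖ ≤ A * h ^ (3 * α - 1)) ∧
      (∀ k : ℕ, (k + 1 : ℕ) * h ≤ T →
        ‖eul W WW h 0 ξ (k + 1) - eul W WW h 0 ξ k‖ ≤ A * h ^ α) := by
  have hα : 0 < α := by linarith
  obtain ⟨R, h₁, hR, hh₁, HR⟩ := heb ‖ξ‖ (norm_nonneg _)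
  obtain ⟨K, hK, hb⟩ := hlb (R + 1) (by linarith)
  obtain ⟨Λ, h₂, hΛ, hh₂, HΛ⟩ := exists_eul_lip hp hlb hc heb (ρ := R + 1) (by linarith)
  obtain ⟨τ, hτ, Hτ⟩ := exists_small_time (α := α) hp hK
  have hsz := sized_const hK
  refine ⟨max (2 * K) (|T| * (Λ * (7 * K ^ 3))), min (min h₁ h₂) (min τ 1), by positivity,
    lt_min (lt_min hh₁ hh₂) (lt_min hτ one_pos), fun h hh hhm => ?_⟩
  have b1 : h ≤ h₁ := hhm.trans ((min_le_left _ _).trans (min_le_left _ _))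
  have b2 : h ≤ h₂ := hhm.trans ((min_le_left _ _).trans (min_le_right _ _))
  have b3 : h ≤ τ := hhm.trans ((min_le_right _ _).trans (min_le_left _ _))
  have b4 : h ≤ 1 := hhm.trans ((min_le_right _ _).trans (min_le_right _ _))
  have hs16 : K * h ^ α ≤ 1 / 16 := (Hτ h hh.le b3).1.trans (smallConst_le _)
  have ha0 : 0 ≤ h ^ α := by positivity
  constructor
  · intro k hk
    have hTk : ∀ l ≤ k, (l : ℝ) * h ∈ Icc 0 T := fun l hl =>
      ⟨by positivity, le_trans (by gcongr) hk⟩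
    have hmid : ∀ l < k, ((2 * l + 1 : ℕ) : ℝ) * (h / 2) ∈ Icc 0 T := fun l hl =>
      ⟨by positivity, le_trans (by
        have : (l : ℝ) + 1 ≤ k := by exact_mod_cast hl
        push_cast; nlinarith) hk⟩
    have hxR : ∀ l ≤ 2 * k, ‖eul W WW (h / 2) 0 ξ l‖ ≤ R := fun l hl =>
      HR (h / 2) (by positivity) (by linarith) 0 le_rfl ξ le_rfl l (by
        have : (l : ℝ) ≤ 2 * k := by exact_mod_cast hl
        nlinarith)
    have hdisp : ∀ {s t : ℝ} {x : V}, s ∈ Icc 0 T → t ∈ Icc 0 T → |t - s| ≤ h → ‖x‖ ≤ R →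
        ‖step W WW s t x‖ ≤ R + 1 := fun hs ht hst hx => by
      have := disp_le_const hb hα.le hs ht hst b4 (hx.trans (by linarith))
      exact (norm_add_le _ _).trans (by linarith)
    have e0 : ∀ l : ℕ, (0 : ℝ) + (2 * l : ℕ) * (h / 2) = l * h := fun l => by push_cast; ring
    have e1 : ∀ l : ℕ, |((l + 1 : ℕ) : ℝ) * h - l * h| = h := fun l => by
      rw [← sub_mul]; push_cast; rw [add_sub_cancel_left, one_mul, abs_of_pos hh]
    have step_le : ∀ l < k, ‖step W WW (0 + l * h) (0 + (l + 1 : ℕ) * h)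
        (eul W WW (h / 2) 0 ξ (2 * l))‖ ≤ R + 1 := fun l hl => by
      rw [zero_add, zero_add]
      exact hdisp (hTk l (by omega)) (hTk (l + 1) (by omega)) (e1 l).le (hxR _ (by omega))
    -- The finer scheme at even indices is an approximate orbit of the coarser one; its local error
    -- is the defect of two half steps against a full step.
    have := norm_sub_eul_le (W := W) (WW := WW) (T := T) (ρ := R + 1) (Λ := Λ) (h := h) (s := 0)
      (N := k) (η := 7 * K ^ 3 * h ^ (3 * α)) hh.le le_rfl (by linarith) hΛ
      (fun s hs y z hy hz N hN => HΛ h hh b2 s hs y z hy hz N hN)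
      (x := fun l => eul W WW (h / 2) 0 ξ (2 * l))
      (fun l hl => (hxR (2 * l) (by omega)).trans (by linarith)) step_le (fun l hl => by
        rw [show 2 * (l + 1) = 2 * l + 1 + 1 by ring, eul_succ, eul_succ, e0,
          show ((2 * l + 1 + 1 : ℕ) : ℝ) = (2 * (l + 1) : ℕ) by push_cast; ring, e0, zero_add,
          zero_add, zero_add]
        have q1 : |((2 * l + 1 : ℕ) : ℝ) * (h / 2) - l * h| ≤ h := by
          rw [show ((2 * l + 1 : ℕ) : ℝ) * (h / 2) - l * h = h / 2 by push_cast; ring,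
            abs_of_pos (by positivity)]
          linarith
        have q2 : |((l + 1 : ℕ) : ℝ) * h - (2 * l + 1 : ℕ) * (h / 2)| ≤ h := by
          rw [show ((l + 1 : ℕ) : ℝ) * h - (2 * l + 1 : ℕ) * (h / 2) = h / 2 by push_cast; ring,
            abs_of_pos (by positivity)]
          linarith
        have r1 : |((2 * l + 1 : ℕ) : ℝ) * (h / 2) - l * h| ^ α ≤ h ^ α := by gcongr
        have r2 : |((l + 1 : ℕ) : ℝ) * h - (2 * l + 1 : ℕ) * (h / 2)| ^ α ≤ h ^ α := by gcongr
        have tl := hTk l (by omega)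
        have tm := hmid l hl
        have xR : ‖eul W WW (h / 2) 0 ξ (2 * l)‖ ≤ R + 1 := (hxR _ (by omega)).trans (by linarith)
        refine (hb.defect_le tl tm r1 (hTk (l + 1) (by omega)) r2 hc xR
          (hdisp tl tm q1 (hxR _ (by omega)))).trans ?_
        rw [rpow_three_mul hh.le]
        have := hsz.defect_size ha0 (norm_nonneg _) ((hb.disp_le tl tm r1 xR).trans
          (hsz.disp_size ha0 (by simpa using hs16))) hb.nonneg hb.nonneg'
        simpa using this)
    refine this.trans ?_
    calc k * (Λ * (7 * K ^ 3 * h ^ (3 * α))) = Λ * (7 * K ^ 3) * (k * h ^ (3 * α)) := by ring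
      _ ≤ Λ * (7 * K ^ 3) * (|T| * h ^ (3 * α - 1)) := by
          gcongr ?_ * ?_
          exact mul_rpow_three_le hh (hk.trans (le_abs_self T))
      _ = |T| * (Λ * (7 * K ^ 3)) * h ^ (3 * α - 1) := by ring
      _ ≤ _ := by gcongr; exact le_max_right _ _
  · intro k hk
    have hk' : (k : ℝ) * h ≤ T := le_trans (by gcongr; omega) hk
    have e : eul W WW h 0 ξ (k + 1) - eul W WW h 0 ξ k
        = disp W WW (0 + k * h) (0 + (k + 1 : ℕ) * h) (eul W WW h 0 ξ k) := by
      rw [eul_succ, step, add_sub_cancel_left]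
    rw [e, zero_add, zero_add]
    refine (disp_le_const hb hα.le ⟨by positivity, hk'⟩ ⟨by positivity, hk⟩ (h := h) ?_ b4
      ((HR h hh b1 0 le_rfl ξ le_rfl k (by linarith)).trans (by linarith))).trans ?_
    · rw [← sub_mul]; push_cast; rw [add_sub_cancel_left, one_mul, abs_of_pos hh]
    · gcongr; exact le_max_left _ _

theorem floor_mul_le {t h : ℝ} (ht : 0 ≤ t) (hh : 0 < h) : (⌊t / h⌋₊ : ℝ) * h ≤ t := by
  have := Nat.floor_le (div_nonneg ht hh.le)
  rwa [le_div_iff₀ hh] at this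

theorem lt_floor_mul {t h : ℝ} (hh : 0 < h) : t < (⌊t / h⌋₊ : ℝ) * h + h := by
  have := Nat.lt_floor_add_one (t / h)
  rw [div_lt_iff₀ hh] at this
  linarith

theorem tendsto_floor_mul {t : ℝ} (ht : 0 ≤ t) :
    Tendsto (fun h : ℝ => (⌊t / h⌋₊ : ℝ) * h) (𝓝[>] 0) (𝓝 t) := by
  have h1 : Tendsto (fun h : ℝ => t - h) (𝓝[>] 0) (𝓝 t) := by
    have : Tendsto (fun h : ℝ => t - h) (𝓝 0) (𝓝 (t - 0)) := (continuous_const.sub continuous_id).tendsto 0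
    rw [sub_zero] at this
    exact this.mono_left nhdsWithin_le_nhds
  refine tendsto_of_tendsto_of_tendsto_of_le_of_le' h1 tendsto_const_nhds ?_ ?_
  · filter_upwards [self_mem_nhdsWithin] with h hh
    have := lt_floor_mul (t := t) hh
    linarith
  · filter_upwards [self_mem_nhdsWithin] with h hh
    exact floor_mul_le ht hh

theorem tendsto_rpow_zero {p : ℝ} (hp : 0 < p) :
    Tendsto (fun h : ℝ => h ^ p) (𝓝[>] 0) (𝓝 0) := by
  have := (Real.continuousAt_rpow_const 0 p (Or.inr hp.le)).tendsto
  rw [Real.zero_rpow hp.ne'] at this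
  exact this.mono_left nhdsWithin_le_nhds

/-- Convergence of the Euler schemes along dyadic meshes. -/
theorem exists_tendsto_eul [CompleteSpace V] (hp : 1 < 3 * α) (hα' : α ≤ 1 / 2) (hT : 0 < T)
    (hlb : LocallyBounded T α W WW) (hc : ChenDiag T W WW) (heb : EulerBounded T W WW) (ξ : V) :
    ∃ (Y : ℝ → V) (h : ℕ → ℝ), Tendsto h atTop (𝓝[>] 0) ∧
      ∀ t ∈ Icc 0 T, Tendsto (fun n => eul W WW (h n) 0 ξ ⌊t / h n⌋₊) atTop (𝓝 (Y t)) := by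
  obtain ⟨A, h₀, hA, hh₀, H⟩ := exists_refine hp hlb hc heb ξ
  have hh0 : Tendsto (fun n : ℕ => T * (1 / 2 : ℝ) ^ n) atTop (𝓝 0) := by
    simpa using (tendsto_pow_atTop_nhds_zero_of_lt_one (r := (1 / 2 : ℝ)) (by norm_num)
      (by norm_num)).const_mul T
  obtain ⟨n₀, hn₀⟩ := (hh0.eventually_le_const (lt_min hh₀ one_pos)).exists
  set h : ℕ → ℝ := fun n => T * (1 / 2 : ℝ) ^ (n + n₀) with hdef
  have hpos : ∀ n, 0 < h n := fun n => by positivity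
  have hhalf : ∀ n, h (n + 1) = h n / 2 := fun n => by
    simp only [hdef]; rw [show n + 1 + n₀ = n + n₀ + 1 by ring, pow_succ]; ring
  have hgeo : ∀ n, h n = h 0 * (1 / 2 : ℝ) ^ n := fun n => by
    simp only [hdef]; rw [pow_add, zero_add]; ring
  have hle : ∀ n, h n ≤ min h₀ 1 := fun n => by
    refine le_trans ?_ hn₀
    rw [hgeo, hdef]; simp only [zero_add]
    exact mul_le_of_le_one_right (by positivity) (pow_le_one₀ (by norm_num) (by norm_num))
  have hcauchy : ∀ t ∈ Icc 0 T, CauchySeq fun n => eul W WW (h n) 0 ξ ⌊t / h n⌋₊ := by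
    intro t ht
    refine cauchySeq_of_le_geometric ((1 / 2 : ℝ) ^ (3 * α - 1)) (2 * A * (h 0) ^ (3 * α - 1))
      (Real.rpow_lt_one (by norm_num) (by norm_num) (by linarith)) fun n => ?_
    have e : 2 * A * h 0 ^ (3 * α - 1) * ((1 / 2 : ℝ) ^ (3 * α - 1)) ^ n
        = 2 * A * h n ^ (3 * α - 1) := by
      rw [hgeo n, Real.mul_rpow (hpos 0).le (by positivity), ← Real.rpow_natCast,
        ← Real.rpow_natCast, ← Real.rpow_mul (by norm_num), ← Real.rpow_mul (by norm_num),
        mul_comm (3 * α - 1) (n : ℝ)]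
      ring
    rw [e, dist_comm, dist_eq_norm, hhalf]
    have hn := hpos n
    obtain ⟨H1, -⟩ := H (h n) hn ((hle n).trans (min_le_left _ _))
    obtain ⟨-, H2⟩ := H (h n / 2) (by positivity)
      (le_trans (by linarith) ((hle n).trans (min_le_left _ _)))
    have hn1 : h n ≤ 1 := (hle n).trans (min_le_right _ _)
    set k := ⌊t / h n⌋₊ with hk
    have hkt := floor_mul_le ht.1 hn
    have hkt' := lt_floor_mul (t := t) hn
    rw [← hk] at hkt hkt'
    have c1 := H1 k (hkt.trans ht.2)
    -- α ≤ 1/2 gives 3α - 1 ≤ α, so an extra half step costs no more than the refinement error.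
    have c2 : (h n / 2) ^ α ≤ h n ^ (3 * α - 1) := by
      calc (h n / 2) ^ α ≤ h n ^ α := by gcongr <;> linarith
        _ ≤ h n ^ (3 * α - 1) :=
          Real.rpow_le_rpow_of_exponent_ge hn hn1 (by linarith)
    have hj1 : 2 * k ≤ ⌊t / (h n / 2)⌋₊ := by
      rw [Nat.le_floor_iff (by have := ht.1; positivity), le_div_iff₀ (by positivity)]
      push_cast; linarith
    have hj2 : ⌊t / (h n / 2)⌋₊ < 2 * k + 2 := by
      rw [Nat.floor_lt (by have := ht.1; positivity), div_lt_iff₀ (by positivity)]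
      push_cast; linarith
    have hP : 0 ≤ A * h n ^ (3 * α - 1) := by positivity
    rcases (by omega : ⌊t / (h n / 2)⌋₊ = 2 * k ∨ ⌊t / (h n / 2)⌋₊ = 2 * k + 1) with hj | hj
    · rw [hj]; linarith
    · have hjt := floor_mul_le ht.1 (half_pos hn)
      rw [hj] at hjt ⊢
      have c3 := H2 (2 * k) (hjt.trans ht.2)
      have c4 : A * (h n / 2) ^ α ≤ A * h n ^ (3 * α - 1) := by gcongr
      refine (norm_sub_le_norm_sub_add_norm_sub _ (eul W WW (h n / 2) 0 ξ (2 * k)) _).trans ?_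
      linarith
  choose! Y hY using fun t (ht : t ∈ Icc 0 T) => cauchySeq_tendsto_of_complete (hcauchy t ht)
  refine ⟨Y, h, ?_, hY⟩
  rw [tendsto_nhdsWithin_iff]
  exact ⟨(hh0.comp (tendsto_add_atTop_nat n₀)), Eventually.of_forall hpos⟩

/-- A path that is close to the Euler steps is the limit of the Euler schemes. -/
theorem tendsto_eul_of_error (hp : 1 < 3 * α)
    (hlb : LocallyBounded T α W WW) (hc : ChenDiag T W WW) (heb : EulerBounded T W WW)
    {Z : ℝ → V} (hZb : ∃ R, ∀ t ∈ Icc 0 T, ‖Z t‖ ≤ R)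
    (hZc : ContinuousOn Z (Icc 0 T)) {L : ℝ} (hL : 0 ≤ L)
    (hZ : ∀ s ∈ Icc 0 T, ∀ t ∈ Icc 0 T, s < t →
      ‖Z t - step W WW s t (Z s)‖ ≤ L * (t - s) ^ (3 * α)) {t : ℝ} (ht : t ∈ Icc 0 T) :
    Tendsto (fun h => eul W WW h 0 (Z 0) ⌊t / h⌋₊) (𝓝[>] 0) (𝓝 (Z t)) := by
  obtain ⟨R, hR⟩ := hZb
  have hT0 : 0 ≤ T := ht.1.trans ht.2
  have hR0 : 0 ≤ R := (norm_nonneg _).trans (hR t ht)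
  have hLT : 0 ≤ L * T ^ (3 * α) := by positivity
  -- The enlarged radius also contains the images of the points of Z under one step.
  obtain ⟨Λ, h₂, hΛ, hh₂, HΛ⟩ := exists_eul_lip hp hlb hc heb (ρ := R + L * T ^ (3 * α))
    (by linarith)
  have c1 : Tendsto (fun h : ℝ => Z (⌊t / h⌋₊ * h)) (𝓝[>] 0) (𝓝 (Z t)) := by
    refine (hZc t ht).tendsto.comp (tendsto_nhdsWithin_iff.2 ⟨tendsto_floor_mul ht.1, ?_⟩)
    filter_upwards [self_mem_nhdsWithin] with h hh
    have hh' : 0 < h := hh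
    exact ⟨by positivity, (floor_mul_le ht.1 hh').trans ht.2⟩
  have c2 : Tendsto (fun h : ℝ => eul W WW h 0 (Z 0) ⌊t / h⌋₊ - Z (⌊t / h⌋₊ * h))
      (𝓝[>] 0) (𝓝 0) := by
    refine squeeze_zero_norm' (a := fun h => T * Λ * L * h ^ (3 * α - 1)) ?_ ?_
    · filter_upwards [self_mem_nhdsWithin, nhdsWithin_le_nhds (Iic_mem_nhds hh₂)] with h hh hhle
      have hh' : 0 < h := hh
      set k := ⌊t / h⌋₊ with hk
      have hkt : k * h ≤ T := (floor_mul_le ht.1 hh').trans ht.2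
      have hmem : ∀ l ≤ k, (l : ℝ) * h ∈ Icc 0 T := fun l hl =>
        ⟨by positivity, le_trans (by gcongr) hkt⟩
      have e1 : ∀ l : ℕ, ((l + 1 : ℕ) : ℝ) * h - l * h = h := fun l => by
        rw [← sub_mul]; push_cast; rw [add_sub_cancel_left, one_mul]
      have herr : ∀ l < k, ‖Z ((l + 1 : ℕ) * h)
          - step W WW (0 + l * h) (0 + (l + 1 : ℕ) * h) (Z (l * h))‖ ≤ L * h ^ (3 * α) := by
        intro l hl
        have := hZ _ (hmem l (by omega)) _ (hmem (l + 1) (by omega)) (by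
          have := e1 l; linarith)
        rw [e1] at this
        rw [zero_add, zero_add]
        exact this
      have := norm_sub_eul_le (W := W) (WW := WW) (T := T) (ρ := R + L * T ^ (3 * α)) (Λ := Λ)
        (h := h) (s := 0) (N := k) hh'.le le_rfl (by linarith) hΛ
        (fun s hs y z hy hz N hN => HΛ h hh' hhle s hs y z hy hz N hN)
        (x := fun l => Z (l * h)) (fun l hl => (hR _ (hmem l hl)).trans (by linarith))
        (fun l hl => by
          have h1 := herr l hl
          have h2 := hR _ (hmem (l + 1) (by omega))
          have h3 : h ≤ T := by
            have := (hmem (l + 1) (by omega)).2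
            have := (hmem l (by omega)).1
            have := e1 l
            linarith
          have h4 : L * h ^ (3 * α) ≤ L * T ^ (3 * α) := by gcongr
          have h5 := norm_le_norm_add_norm_sub (Z ((l + 1 : ℕ) * h))
            (step W WW (0 + l * h) (0 + (l + 1 : ℕ) * h) (Z (l * h)))
          linarith) herr
      rw [norm_sub_rev]
      rw [Nat.cast_zero, zero_mul] at this
      refine this.trans ?_
      calc k * (Λ * (L * h ^ (3 * α))) = Λ * L * (k * h ^ (3 * α)) := by ring
        _ ≤ Λ * L * (T * h ^ (3 * α - 1)) := by
            gcongr ?_ * ?_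
            exact mul_rpow_three_le hh' hkt
        _ = _ := by ring
    · simpa using (tendsto_rpow_zero (by linarith : 0 < 3 * α - 1)).const_mul (T * Λ * L)
  simpa using c2.add c1

end Limit

/-! ### Solutions and the one-step estimate. -/

section Solution

theorem IsPartition.le {s t : ℝ} {m : ℕ} {τ : ℕ → ℝ} (h : IsPartition s t m τ) {i j : ℕ}
    (hij : i ≤ j) (hj : j ≤ m) : τ i ≤ τ j := by
  induction j, hij using Nat.le_induction with
  | base => exact le_rfl
  | succ j _ ih => exact (ih (by omega)).trans (h.lt j (by omega)).le

theorem IsPartition.mem {s t : ℝ} {m : ℕ} {τ : ℕ → ℝ} (h : IsPartition s t m τ) {k : ℕ}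
    (hk : k ≤ m) : τ k ∈ Icc s t := by
  constructor
  · rw [← h.left]; exact h.le (Nat.zero_le k) hk
  · rw [← h.right]; exact h.le hk le_rfl

variable {V : Type*} [NormedAddCommGroup V] {T α ρ : ℝ} {W : ℝ → V → V}
  {WW : ℝ → ℝ → V × V → V}

/-- A path that is close to the Euler steps over short times satisfies the rough integral
equation. -/
theorem hasRoughIntegral_of_error (hp : 1 < 3 * α) {Y : ℝ → V} {L τ₀ : ℝ} (hL : 0 ≤ L)
    (hτ₀ : 0 < τ₀)
    (hY : ∀ s ∈ Icc 0 T, ∀ t ∈ Icc 0 T, s < t → t - s < τ₀ →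
      ‖Y t - step W WW s t (Y s)‖ ≤ L * (t - s) ^ (3 * α)) {t : ℝ} (ht : t ∈ Icc 0 T) :
    HasRoughIntegral W WW Y Y 0 t (Y t - Y 0) := by
  intro ε hε
  have h1 : Tendsto (fun δ : ℝ => L * t * δ ^ (3 * α - 1)) (𝓝[>] 0) (𝓝 0) := by
    simpa using (tendsto_rpow_zero (by linarith : 0 < 3 * α - 1)).const_mul (L * t)
  obtain ⟨δ, ⟨hδε, hδτ⟩, hδ⟩ := ((h1.eventually_lt_const hε).and
    (nhdsWithin_le_nhds (Iio_mem_nhds hτ₀)) |>.and self_mem_nhdsWithin).exists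
  have hδ' : 0 < δ := hδ
  refine ⟨δ, hδ', fun m τ hτ hmesh => ?_⟩
  -- The increments of Y telescope, so the deviation of the Riemann sum is minus the sum of the
  -- one-step errors.
  have e : ∑ k ∈ Finset.range m, (W (τ (k + 1)) (Y (τ k)) - W (τ k) (Y (τ k))
      + WW (τ k) (τ (k + 1)) (Y (τ k), Y (τ k))) - (Y t - Y 0)
      = - ∑ k ∈ Finset.range m, (Y (τ (k + 1)) - step W WW (τ k) (τ (k + 1)) (Y (τ k))) := by
    have e1 := Finset.sum_range_sub (fun k => Y (τ k)) m
    rw [hτ.left, hτ.right] at e1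
    rw [← e1, ← Finset.sum_sub_distrib, ← Finset.sum_neg_distrib]
    refine Finset.sum_congr rfl fun k _ => ?_
    simp only [step, disp, inc, dia]
    abel
  rw [e, norm_neg]
  refine lt_of_le_of_lt ?_ hδε
  have ht0 : ∀ k ≤ m, τ k ∈ Icc 0 T := fun k hk =>
    ⟨(hτ.mem hk).1, (hτ.mem hk).2.trans ht.2⟩
  calc ‖∑ k ∈ Finset.range m, (Y (τ (k + 1)) - step W WW (τ k) (τ (k + 1)) (Y (τ k)))‖
      ≤ ∑ k ∈ Finset.range m, L * δ ^ (3 * α - 1) * (τ (k + 1) - τ k) := by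
        refine norm_sum_le_of_le _ fun k hk => ?_
        have hk' : k < m := Finset.mem_range.1 hk
        have hlt := sub_pos.2 (hτ.lt k hk')
        refine (hY _ (ht0 k hk'.le) _ (ht0 (k + 1) hk') (hτ.lt k hk')
          ((hmesh k hk').trans hδτ)).trans ?_
        rw [mul_assoc]
        gcongr
        calc (τ (k + 1) - τ k) ^ (3 * α)
            = (τ (k + 1) - τ k) ^ (3 * α - 1) * (τ (k + 1) - τ k) := by
              rw [← Real.rpow_add_one hlt.ne']; ring_nf
          _ ≤ _ := by
              gcongr
              exact (hmesh k hk').le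
    _ = L * t * δ ^ (3 * α - 1) := by
        rw [← Finset.mul_sum, Finset.sum_range_sub τ m, hτ.left, hτ.right]; ring

/-- At distances of at least τ₀ boundedness alone gives the estimate. -/
theorem isHolder₂_of_local {γ C M τ₀ : ℝ} (hγ : 0 ≤ γ) (hτ₀ : 0 < τ₀)
    {F : ℝ → ℝ → V}
    (hF : ∀ s ∈ Icc 0 T, ∀ t ∈ Icc 0 T, s ≠ t → |t - s| < τ₀ → ‖F s t‖ ≤ C * |t - s| ^ γ)
    (hM : ∀ s ∈ Icc 0 T, ∀ t ∈ Icc 0 T, ‖F s t‖ ≤ M) : IsHolder₂ T γ F := by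
  refine ⟨max C (M / τ₀ ^ γ), fun s hs t ht hst => ?_⟩
  rcases lt_or_ge |t - s| τ₀ with h | h
  · refine (hF s hs t ht hst h).trans ?_
    gcongr
    exact le_max_left _ _
  · have hM0 : 0 ≤ M := (norm_nonneg _).trans (hM s hs t ht)
    calc ‖F s t‖ ≤ M := hM s hs t ht
      _ = M / τ₀ ^ γ * τ₀ ^ γ := by field_simp
      _ ≤ max C (M / τ₀ ^ γ) * |t - s| ^ γ := by
          gcongr
          exact le_max_right _ _

variable [NormedSpace ℝ V]

theorem abs_sub_le_of_mem {s t : ℝ} (hs : s ∈ Icc 0 T) (ht : t ∈ Icc 0 T) : |t - s| ≤ T := by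
  rw [abs_le]; constructor <;> linarith [hs.1, hs.2, ht.1, ht.2]

/-- A bounded path that is close to the Euler steps over short times is a solution. -/
theorem isSolution_of_error (hp : 1 < 3 * α)
    (hlb : LocallyBounded T α W WW) {Y : ℝ → V} {R L τ₀ : ℝ} (hR0 : 0 ≤ R)
    (hR : ∀ t ∈ Icc 0 T, ‖Y t‖ ≤ R) (hL : 0 ≤ L) (hτ₀ : 0 < τ₀)
    (hY : ∀ s ∈ Icc 0 T, ∀ t ∈ Icc 0 T, s < t → t - s < τ₀ →
      ‖Y t - step W WW s t (Y s)‖ ≤ L * (t - s) ^ (3 * α)) :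
    IsSolution T α W WW (Y 0) Y := by
  have hα : 0 < α := by linarith
  obtain ⟨K, hK, hb⟩ := hlb R hR0
  have hinc : ∀ s ∈ Icc 0 T, ∀ t ∈ Icc 0 T, ‖inc W s t (Y s)‖ ≤ K * |t - s| ^ α :=
    fun s hs t ht => hb.inc_le s hs t ht _ (hR s hs)
  have hYM : ∀ s ∈ Icc 0 T, ∀ t ∈ Icc 0 T, ‖Y t - Y s‖ ≤ R + R := fun s hs t ht =>
    (norm_sub_le _ _).trans (add_le_add (hR t ht) (hR s hs))
  have hrem : ∀ s ∈ Icc 0 T, ∀ t ∈ Icc 0 T, s < t → |t - s| < τ₀ →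
      ‖Y t - Y s - inc W s t (Y s)‖ ≤ (L * T ^ α + K) * |t - s| ^ (2 * α) := by
    intro s hs t ht hst htau
    have hpos : 0 < t - s := sub_pos.2 hst
    have h1 := hY s hs t ht hst (by rwa [abs_of_pos hpos] at htau)
    have h2 := hb.dia_le s hs t ht _ (hR s hs)
    have e : Y t - Y s - inc W s t (Y s) = (Y t - step W WW s t (Y s)) + dia WW s t (Y s) := by
      simp only [step, disp]; abel
    have h3 : (t - s) ^ (3 * α) ≤ T ^ α * |t - s| ^ (2 * α) := by
      rw [abs_of_pos hpos, show 3 * α = α + 2 * α by ring, Real.rpow_add hpos]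
      gcongr
      linarith [hs.1, ht.2]
    rw [e, add_mul]
    refine (norm_add_le _ _).trans (add_le_add (h1.trans ?_) h2)
    rw [mul_assoc]
    gcongr
  have hhol : ∀ s ∈ Icc 0 T, ∀ t ∈ Icc 0 T, s < t → |t - s| < τ₀ →
      ‖Y t - Y s‖ ≤ ((L * T ^ α + K) * T ^ α + K) * |t - s| ^ α := by
    intro s hs t ht hst htau
    have h1 := hrem s hs t ht hst htau
    have h2 := hinc s hs t ht
    have h3 : |t - s| ^ (2 * α) ≤ T ^ α * |t - s| ^ α := by
      rw [abs_rpow_two_mul, pow_two]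
      gcongr
      exact abs_sub_le_of_mem hs ht
    have e : Y t - Y s = (Y t - Y s - inc W s t (Y s)) + inc W s t (Y s) := by abel
    rw [e, add_mul]
    refine (norm_add_le _ _).trans (add_le_add (h1.trans ?_) h2)
    rw [mul_assoc (L * T ^ α + K)]
    have : 0 ≤ T := hs.1.trans hs.2
    gcongr
  have hholder : IsHolder T α Y := by
    refine isHolder₂_of_local hα.le hτ₀ (C := (L * T ^ α + K) * T ^ α + K) (M := R + R)
      (fun s hs t ht hst htau => ?_) hYM
    rcases lt_or_gt_of_ne hst with h | h
    · exact hhol s hs t ht h htau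
    · rw [norm_sub_rev, abs_sub_comm]
      exact hhol t ht s hs h (by rwa [abs_sub_comm])
  have hremainder : IsHolder₂ T (2 * α) fun s t => Y t - Y s - (W t (Y s) - W s (Y s)) := by
    refine isHolder₂_of_local (by positivity) hτ₀
      (C := (L * T ^ α + K) + K * ((L * T ^ α + K) * T ^ α + K)) (M := R + R + K * T ^ α)
      (fun s hs t ht hst htau => ?_) (fun s hs t ht => ?_)
    · change ‖Y t - Y s - inc W s t (Y s)‖ ≤ _
      have hT : 0 ≤ T := hs.1.trans hs.2
      rcases lt_or_gt_of_ne hst with h | h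
      · refine (hrem s hs t ht h htau).trans ?_
        have : 0 ≤ K * ((L * T ^ α + K) * T ^ α + K) := by positivity
        exact mul_le_mul_of_nonneg_right (by linarith) (by positivity)
      · have h1 := hrem t ht s hs h (by rwa [abs_sub_comm])
        have h2 := hhol t ht s hs h (by rwa [abs_sub_comm])
        have h3 := hb.inc_lip ht hs (le_refl _) (hR s hs) (hR t ht)
        -- The one-step estimate only runs forward in time. Exchanging s and t costs an increment of
        -- W_{t,s} between Y_s and Y_t, which is of order 2α.
        have e : Y t - Y s - inc W s t (Y s) = -(Y s - Y t - inc W t s (Y t))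
            + (inc W t s (Y s) - inc W t s (Y t)) := by
          simp only [inc]; abel
        rw [e, add_mul, abs_sub_comm t s]
        refine (norm_add_le _ _).trans (add_le_add (by rwa [norm_neg]) (h3.trans ?_))
        rw [abs_rpow_two_mul, pow_two]
        calc K * |s - t| ^ α * ‖Y s - Y t‖
            ≤ K * |s - t| ^ α * (((L * T ^ α + K) * T ^ α + K) * |s - t| ^ α) := by gcongr
          _ = _ := by ring
    · refine (norm_sub_le _ _).trans (add_le_add (hYM s hs t ht) ((hinc s hs t ht).trans ?_))
      gcongr
      exact abs_sub_le_of_mem hs ht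
  exact ⟨⟨hholder, hholder, hremainder⟩, rfl, fun t ht =>
    ⟨Y t - Y 0, hasRoughIntegral_of_error hp hL hτ₀ hY ht, by abel⟩⟩

theorem uniform_isPartition {s t : ℝ} {N : ℕ} (hN : 0 < N) (hst : s < t) :
    IsPartition s t N fun k => s + k * ((t - s) / N) := by
  have hN' : (0 : ℝ) < N := by exact_mod_cast hN
  refine ⟨by simp, by field_simp; ring, fun k _ => ?_⟩
  have : 0 < (t - s) / N := div_pos (sub_pos.2 hst) hN'
  push_cast
  nlinarith

theorem exists_uniform_partition {s t δ : ℝ} (hst : s ≤ t) (hδ : 0 < δ) :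
    ∃ (N : ℕ) (h : ℝ), 0 ≤ h ∧ h < δ ∧ N * h = t - s ∧ IsPartition s t N fun k => s + k * h := by
  rcases hst.eq_or_lt with rfl | hst
  · exact ⟨0, 0, le_rfl, hδ, by simp, by simp, by simp, by simp⟩
  · obtain ⟨N, hN⟩ := exists_nat_gt ((t - s) / δ)
    have hts := sub_pos.2 hst
    have hN0 : (0 : ℝ) < N := (div_pos hts hδ).trans hN
    refine ⟨N, (t - s) / N, by positivity, ?_, by field_simp,
      uniform_isPartition (by exact_mod_cast hN0) hst⟩
    rw [div_lt_iff₀ hN0]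
    rwa [div_lt_iff₀ hδ, mul_comm] at hN

/-- The integral is only given from time 0; partitions of [0,s] are continued to [0,t] in order to
isolate [s,t]. -/
theorem IsPartition.append {r s t : ℝ} {m n : ℕ} {σ τ : ℕ → ℝ} (hσ : IsPartition r s m σ)
    (hτ : IsPartition s t n τ) :
    IsPartition r t (m + n) fun k => if k ≤ m then σ k else τ (k - m) where
  left := by simpa using hσ.left
  right := by
    rcases Nat.eq_zero_or_pos n with rfl | hn
    · simp [hσ.right, ← hτ.right, hτ.left]
    · simp [show ¬ (n = 0) by omega, hτ.right]
  lt k hk := by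
    rcases Nat.lt_trichotomy k m with h | h | h
    · simp only [h.le, if_true, show k + 1 ≤ m from h]; exact hσ.lt k h
    · subst h
      simp only [le_refl, if_true, show ¬ (k + 1 ≤ k) by omega, if_false, hσ.right]
      rw [← hτ.left, show k + 1 - k = 0 + 1 by omega]
      exact hτ.lt 0 (by omega)
    · simp only [show ¬ (k ≤ m) by omega, show ¬ (k + 1 ≤ m) by omega, if_false]
      rw [show k + 1 - m = k - m + 1 by omega]
      exact hτ.lt (k - m) (by omega)

omit [NormedSpace ℝ V] in
theorem sum_append {m n : ℕ} {σ τ : ℕ → ℝ} (h : σ m = τ 0) (F : ℝ → ℝ → V) :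
    ∑ k ∈ Finset.range (m + n), F (if k ≤ m then σ k else τ (k - m))
        (if k + 1 ≤ m then σ (k + 1) else τ (k + 1 - m))
      = ∑ k ∈ Finset.range m, F (σ k) (σ (k + 1)) + ∑ k ∈ Finset.range n, F (τ k) (τ (k + 1)) := by
  rw [Finset.sum_range_add]
  congr 1
  · refine Finset.sum_congr rfl fun k hk => ?_
    have hk := Finset.mem_range.1 hk
    rw [if_pos hk.le, if_pos (Nat.succ_le_of_lt hk)]
  · refine Finset.sum_congr rfl fun k _ => ?_
    rw [if_neg (by omega : ¬ m + k + 1 ≤ m), show m + k + 1 - m = k + 1 by omega]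
    rcases Nat.eq_zero_or_pos k with rfl | hk
    · simp [h]
    · rw [if_neg (by omega), show m + k - m = k by omega]

/-- A solution is close to the Euler steps. -/
theorem IsSolution.exists_error (hp : 1 < 3 * α) {ξ : V}
    (hlb : LocallyBounded T α W WW) (hc : ChenDiag T W WW) {Z : ℝ → V}
    (hZ : IsSolution T α W WW ξ Z) {R : ℝ} (hR0 : 0 ≤ R) (hR : ∀ t ∈ Icc 0 T, ‖Z t‖ ≤ R) :
    ∃ L, 0 ≤ L ∧ ∀ s ∈ Icc 0 T, ∀ t ∈ Icc 0 T, s < t →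
      ‖Z t - step W WW s t (Z s)‖ ≤ L * (t - s) ^ (3 * α) := by
  have hα : 0 < α := by linarith
  obtain ⟨K, hK, hb⟩ := hlb R hR0
  obtain ⟨C₁, hC₁⟩ := hZ.controlled.holder
  obtain ⟨C₂, hC₂⟩ := hZ.controlled.remainder
  set κ := K * |C₁| ^ 2 + K * |C₂| + K * |C₁| with hκ
  have hκ0 : 0 ≤ κ := by positivity
  set Ξ : ℝ → ℝ → V := fun a b => disp W WW a b (Z a) with hΞ
  have hdef : ∀ a ∈ Icc 0 T, ∀ b ∈ Icc 0 T, ∀ c ∈ Icc 0 T, a < b → b < c →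
      ‖Ξ a c - Ξ a b - Ξ b c‖ ≤ κ * (c - a) ^ (3 * α) := by
    intro a ha b hb' c hc' hab hbc
    rw [rpow_three_mul (by linarith)]
    set q := (c - a) ^ α with hq
    have hq0 : 0 ≤ q := Real.rpow_nonneg (by linarith) _
    have r1 : |b - a| ^ α ≤ q := by
      rw [abs_of_pos (by linarith), hq]; gcongr
    have r2 : |c - b| ^ α ≤ q := by
      rw [abs_of_pos (by linarith), hq]; gcongr
    have y1 : ‖Z b - Z a‖ ≤ |C₁| * q := (hC₁ a ha b hb' hab.ne).trans (by
      gcongr; exact le_abs_self _)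
    have y2 : ‖Z b - Z a - inc W a b (Z a)‖ ≤ |C₂| * q ^ 2 := by
      refine (hC₂ a ha b hb' hab.ne).trans ?_
      rw [abs_rpow_two_mul]
      gcongr
      exact le_abs_self _
    -- Chen's relation produces DW_{b,c}(Z_a) applied to W_{a,b}(Z_a). Replacing this argument by
    -- Z_b - Z_a completes a Taylor remainder and leaves the controlled remainder, of order 2α.
    have e : Ξ a c - Ξ a b - Ξ b c
        = -(inc W b c (Z a + (Z b - Z a)) - inc W b c (Z a)
            - fderiv ℝ (inc W b c) (Z a) (Z b - Z a))
          + -(fderiv ℝ (inc W b c) (Z a) (Z b - Z a - inc W a b (Z a)))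
          + -(dia WW b c (Z b) - dia WW b c (Z a)) := by
      rw [add_sub_cancel, map_sub _ (Z b - Z a)]
      have h1 : inc W a c (Z a) = inc W a b (Z a) + inc W b c (Z a) := by simp [inc]
      simp only [hΞ, disp]
      rw [hc a ha b hb' c hc' (Z a), h1]
      abel
    rw [e]
    refine (norm_add₃_le).trans ?_
    rw [norm_neg, norm_neg, norm_neg]
    have t1 := norm_taylor_le (hb.diff_inc b hb' c hc')
      (fun _ _ hx hy => hb.inc'_lip hb' hc' r2 hx hy) (by positivity) (hR a ha)
      (v := Z b - Z a) (by simpa using hR b hb')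
    have t2 : ‖fderiv ℝ (inc W b c) (Z a) (Z b - Z a - inc W a b (Z a))‖
        ≤ K * q * (|C₂| * q ^ 2) := by
      refine (ContinuousLinearMap.le_opNorm _ _).trans ?_
      gcongr
      exact hb.inc'_le_of hb' hc' r2 (hR a ha)
    have t3 := hb.dia_lip hb' hc' r2 (hR b hb') (hR a ha)
    have t1' : K * q * ‖Z b - Z a‖ ^ 2 ≤ K * q * (|C₁| * q) ^ 2 := by gcongr
    have t3' : K * q ^ 2 * ‖Z b - Z a‖ ≤ K * q ^ 2 * (|C₁| * q) := by gcongr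
    have : κ * q ^ 3 = K * q * (|C₁| * q) ^ 2 + K * q * (|C₂| * q ^ 2)
        + K * q ^ 2 * (|C₁| * q) := by rw [hκ]; ring
    linarith
  have hS := sewConst_pos hp
  refine ⟨sewConst (3 * α) * κ, by positivity, fun s hs t ht hst => ?_⟩
  refine le_of_forall_pos_le_add fun ε hε => ?_
  obtain ⟨I, hI, hZI⟩ := hZ.eqn s hs
  obtain ⟨J, hJ, hZJ⟩ := hZ.eqn t ht
  obtain ⟨δ₁, hδ₁, H₁⟩ := hI (ε / 2) (half_pos hε)
  obtain ⟨δ₂, hδ₂, H₂⟩ := hJ (ε / 2) (half_pos hε)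
  obtain ⟨m, h', hh'0, hh', -, hm⟩ := exists_uniform_partition hs.1 (lt_min hδ₁ hδ₂)
  obtain ⟨N, h, hh0, hh, hNh, hN⟩ := exists_uniform_partition hst.le (lt_min hδ₁ hδ₂)
  set σ : ℕ → ℝ := fun k => 0 + k * h' with hσ
  set τ : ℕ → ℝ := fun k => s + k * h with hτ
  have hστ : σ m = τ 0 := by rw [hm.right, hN.left]
  have hmesh' : ∀ k, σ (k + 1) - σ k = h' := fun k => by simp only [hσ]; push_cast; ring
  have hmesh : ∀ k, τ (k + 1) - τ k = h := fun k => by simp only [hτ]; push_cast; ring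
  have G₁ := H₁ m σ hm fun k _ => by rw [hmesh']; exact hh'.trans_le (min_le_left _ _)
  -- The two partitions agree on [0,s], so the corresponding sums cancel in the difference of the
  -- two integrals.
  have G₂ := H₂ (m + N) _ (hm.append hN) fun k hk => by
    rcases Nat.lt_trichotomy k m with hkm | hkm | hkm
    · rw [if_pos hkm.le, if_pos (Nat.succ_le_of_lt hkm), hmesh']; exact hh'.trans_le (min_le_right _ _)
    · subst hkm
      rw [if_pos le_rfl, if_neg (by omega), hστ, show k + 1 - k = 0 + 1 by omega, hmesh]
      exact hh.trans_le (min_le_right _ _)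
    · rw [if_neg (by omega), if_neg (by omega), show k + 1 - m = k - m + 1 by omega, hmesh]
      exact hh.trans_le (min_le_right _ _)
  change ‖∑ k ∈ Finset.range (m + N), Ξ (if k ≤ m then σ k else τ (k - m))
    (if k + 1 ≤ m then σ (k + 1) else τ (k + 1 - m)) - J‖ < ε / 2 at G₂
  change ‖∑ k ∈ Finset.range m, Ξ (σ k) (σ (k + 1)) - I‖ < ε / 2 at G₁
  rw [sum_append hστ] at G₂
  have hmem : ∀ k ≤ N, τ k ∈ Icc 0 T := fun k hk =>
    ⟨hs.1.trans (hN.mem hk).1, (hN.mem hk).2.trans ht.2⟩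
  have hN0 : 0 < N := by
    rcases Nat.eq_zero_or_pos N with rfl | h
    · have := hN.right; have := hN.left; linarith
    · exact h
  -- Here Z is given, so no error is propagated and ε = 0: this is plain additive sewing.
  have hsew := discrete_sewing hp (ε := 0) le_rfl (smallConst_ratio hp (by
      have := smallConst_pos hp; linarith)) hκ0 hh0 (m := N)
    (A := fun i k => ‖∑ l ∈ Finset.Ico i k, Ξ (τ l) (τ (l + 1)) - Ξ (τ i) (τ k)‖)
    (fun i _ => by simp) (fun i j k hij hjk hk => by
      have h1 := hdef _ (hmem i (by omega)) _ (hmem j (by omega)) _ (hmem k hk)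
        (lt_of_lt_of_le (hN.lt i (by omega)) (hN.le (by omega) (by omega)))
        (lt_of_lt_of_le (hN.lt j (by omega)) (hN.le (by omega) (by omega)))
      rw [show τ k - τ i = ((k : ℝ) - i) * h by simp only [hτ]; ring] at h1
      rw [← Finset.sum_Ico_consecutive _ hij.le hjk.le]
      have e : ∑ l ∈ Finset.Ico i j, Ξ (τ l) (τ (l + 1)) + ∑ l ∈ Finset.Ico j k, Ξ (τ l) (τ (l + 1))
          - Ξ (τ i) (τ k)
          = (∑ l ∈ Finset.Ico i j, Ξ (τ l) (τ (l + 1)) - Ξ (τ i) (τ j))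
            + (∑ l ∈ Finset.Ico j k, Ξ (τ l) (τ (l + 1)) - Ξ (τ j) (τ k))
            + -(Ξ (τ i) (τ k) - Ξ (τ i) (τ j) - Ξ (τ j) (τ k)) := by abel
      rw [e]
      refine (norm_add₃_le).trans ?_
      rw [norm_neg]
      linarith) 0 N hN0 le_rfl
  simp only [hN.left, hN.right, Nat.Ico_zero_eq_range] at hsew
  rw [Nat.cast_zero, sub_zero, hNh] at hsew
  have e : Z t - step W WW s t (Z s)
      = (∑ k ∈ Finset.range N, Ξ (τ k) (τ (k + 1)) - Ξ s t)
        + (∑ k ∈ Finset.range m, Ξ (σ k) (σ (k + 1)) - I)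
        - (∑ k ∈ Finset.range m, Ξ (σ k) (σ (k + 1))
          + ∑ k ∈ Finset.range N, Ξ (τ k) (τ (k + 1)) - J) := by
    rw [hZJ, step, hΞ]; simp only; rw [hZI]; abel
  rw [e]
  refine (norm_sub_le _ _).trans ?_
  have := norm_add_le (∑ k ∈ Finset.range N, Ξ (τ k) (τ (k + 1)) - Ξ s t)
    (∑ k ∈ Finset.range m, Ξ (σ k) (σ (k + 1)) - I)
  linarith

end Solution

/-! ### Passage to the limit and uniqueness. -/

section Existence

variable {V : Type*} [NormedAddCommGroup V] {T α ρ : ℝ} {W : ℝ → V → V}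
  {WW : ℝ → ℝ → V × V → V}

theorem IsHolder.continuousOn (hα : 0 < α) {Y : ℝ → V} (hY : IsHolder T α Y) :
    ContinuousOn Y (Icc 0 T) := by
  obtain ⟨C, hC⟩ := hY
  intro t ht
  rw [ContinuousWithinAt, tendsto_iff_norm_sub_tendsto_zero]
  have h1 : Tendsto (fun s : ℝ => |C| * |s - t| ^ α) (𝓝[Icc 0 T] t) (𝓝 0) := by
    have : Tendsto (fun s : ℝ => |C| * |s - t| ^ α) (𝓝 t) (𝓝 (|C| * |t - t| ^ α)) := by
      refine Continuous.tendsto ?_ t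
      exact continuous_const.mul ((continuous_abs.comp (continuous_id.sub continuous_const)).rpow_const
        fun _ => Or.inr hα.le)
    rw [sub_self, abs_zero, Real.zero_rpow hα.ne', mul_zero] at this
    exact this.mono_left nhdsWithin_le_nhds
  refine squeeze_zero' (Eventually.of_forall fun _ => norm_nonneg _) ?_ h1
  filter_upwards [self_mem_nhdsWithin] with s hs
  by_cases hst : t = s
  · subst hst; simp [Real.zero_rpow hα.ne']
  · refine (hC t ht s hs hst).trans ?_
    gcongr
    exact le_abs_self C

variable [NormedSpace ℝ V]

/-- Applying Chen's relation twice leaves only terms with a factor living on a short interval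
between s and s' or between t and t'. Continuity of 𝕎 in time follows from this. -/
theorem disp_sub_eq (hc : ChenDiag T W WW) {s s' t t' : ℝ} (hs : s ∈ Icc 0 T) (hs' : s' ∈ Icc 0 T)
    (ht : t ∈ Icc 0 T) (ht' : t' ∈ Icc 0 T) (y : V) :
    disp W WW s' t' y - disp W WW s t y = (disp W WW s' s y + disp W WW t t' y)
      + (fderiv ℝ (inc W s t') y (inc W s' s y) + fderiv ℝ (inc W t t') y (inc W s t y)) := by
  simp only [disp]
  rw [hc s' hs' s hs t' ht' y, hc s hs t ht t' ht' y]
  have : inc W s' t' y = inc W s' s y + inc W s t y + inc W t t' y := by simp [inc]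
  rw [this]; abel

/-- Joint continuity of an Euler step in time and space. -/
theorem tendsto_disp (hα : 0 < α) (hlb : LocallyBounded T α W WW) (hc : ChenDiag T W WW)
    {ι : Type*} {l : Filter ι} {s t : ℝ} (hs : s ∈ Icc 0 T) (ht : t ∈ Icc 0 T) {y : V}
    {s' t' : ι → ℝ} {y' : ι → V} (hs' : ∀ᶠ i in l, s' i ∈ Icc 0 T)
    (ht' : ∀ᶠ i in l, t' i ∈ Icc 0 T) (hsl : Tendsto s' l (𝓝 s)) (htl : Tendsto t' l (𝓝 t))
    (hyl : Tendsto y' l (𝓝 y)) :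
    Tendsto (fun i => disp W WW (s' i) (t' i) (y' i)) l (𝓝 (disp W WW s t y)) := by
  obtain ⟨K, hK, hb⟩ := hlb (‖y‖ + 1) (by positivity)
  have hT : 0 ≤ T := hs.1.trans hs.2
  have hpow : ∀ {x : ι → ℝ} {x₀ : ℝ}, Tendsto x l (𝓝 x₀) →
      Tendsto (fun i => |x i - x₀| ^ α) l (𝓝 0) := fun {x x₀} hx => by
    have := ((hx.sub_const x₀).abs).rpow_const (p := α) (Or.inr hα.le)
    simpa [Real.zero_rpow hα.ne'] using this
  have ha := hpow hsl
  have hb' := hpow htl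
  rw [tendsto_iff_norm_sub_tendsto_zero] at hyl ⊢
  set q := T ^ α with hq
  have hq0 : 0 ≤ q := by positivity
  have hlim : Tendsto (fun i => (K * q + K * q ^ 2) * ‖y' i - y‖
      + ((K * |s' i - s| ^ α + K * (|s' i - s| ^ α) ^ 2)
        + (K * |t' i - t| ^ α + K * (|t' i - t| ^ α) ^ 2)
        + (K * q * (K * |s' i - s| ^ α) + K * |t' i - t| ^ α * (K * q)))) l (𝓝 0) := by
    have := (hyl.const_mul (K * q + K * q ^ 2)).add
      ((((ha.const_mul K).add ((ha.pow 2).const_mul K)).add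
        ((hb'.const_mul K).add ((hb'.pow 2).const_mul K))).add
        (((ha.const_mul K).const_mul (K * q)).add ((hb'.const_mul K).mul_const (K * q))))
    simpa using this
  refine squeeze_zero' (Eventually.of_forall fun _ => norm_nonneg _) ?_ hlim
  filter_upwards [hs', ht', hyl.eventually_le_const one_pos] with i hsi hti hyi
  have hy0 : ‖y‖ ≤ ‖y‖ + 1 := by linarith
  have hy1 : ‖y' i‖ ≤ ‖y‖ + 1 := by
    have := norm_le_norm_add_norm_sub y (y' i)
    rw [norm_sub_rev] at this
    linarith
  have hqT : ∀ {a b : ℝ}, a ∈ Icc 0 T → b ∈ Icc 0 T → |b - a| ^ α ≤ q := fun h1 h2 => by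
    rw [hq]; gcongr; exact abs_sub_le_of_mem h1 h2
  have rs : |s - s' i| ^ α ≤ |s' i - s| ^ α := by rw [abs_sub_comm]
  have e : disp W WW (s' i) (t' i) (y' i) - disp W WW s t y
      = (disp W WW (s' i) (t' i) (y' i) - disp W WW (s' i) (t' i) y)
        + (disp W WW (s' i) (t' i) y - disp W WW s t y) := by abel
  rw [e, disp_sub_eq hc hs hsi ht hti]
  refine (norm_add_le _ _).trans (add_le_add (hb.disp_lip hsi hti (hqT hsi hti) hy1 hy0) ?_)
  refine (norm_add_le _ _).trans (add_le_add ((norm_add_le _ _).trans (add_le_add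
    (hb.disp_le hsi hs rs hy0) (hb.disp_le ht hti le_rfl hy0)))
    ((norm_add_le _ _).trans (add_le_add ?_ ?_)))
  · refine (ContinuousLinearMap.le_opNorm _ _).trans ?_
    gcongr
    · exact hb.inc'_le_of hs hti (hqT hs hti) hy0
    · exact hb.inc_le_of hsi hs rs hy0
  · refine (ContinuousLinearMap.le_opNorm _ _).trans ?_
    gcongr
    · exact hb.inc'_le_of ht hti le_rfl hy0
    · exact hb.inc_le_of hs ht (hqT hs ht) hy0

theorem exists_isSolution [CompleteSpace V] (hp : 1 < 3 * α) (hα' : α ≤ 1 / 2) (hT : 0 < T)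
    (hlb : LocallyBounded T α W WW) (hc : ChenDiag T W WW) (heb : EulerBounded T W WW) (ξ : V) :
    ∃ Y : ℝ → V, ∃ h : ℕ → ℝ, IsSolution T α W WW ξ Y ∧ Tendsto h atTop (𝓝[>] 0) ∧
      ∀ t ∈ Icc 0 T, Tendsto (fun n => eul W WW (h n) 0 ξ ⌊t / h n⌋₊) atTop (𝓝 (Y t)) := by
  have hα : 0 < α := by linarith
  obtain ⟨Y, h, hh, hY⟩ := exists_tendsto_eul hp hα' hT hlb hc heb ξ
  obtain ⟨R, h₁, hR0, hh₁, HR⟩ := heb ‖ξ‖ (norm_nonneg _)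
  obtain ⟨L, τ, h₂, hL, hτ, hh₂, HL⟩ := exists_eul_error hp hlb hc heb hR0
  have hpos : ∀ᶠ n in atTop, 0 < h n := hh self_mem_nhdsWithin
  have hle₁ : ∀ᶠ n in atTop, h n ≤ h₁ := hh (nhdsWithin_le_nhds (Iic_mem_nhds hh₁))
  have hle₂ : ∀ᶠ n in atTop, h n ≤ h₂ := hh (nhdsWithin_le_nhds (Iic_mem_nhds hh₂))
  have hgrid : ∀ t ∈ Icc 0 T, ∀ᶠ n in atTop, (⌊t / h n⌋₊ : ℝ) * h n ∈ Icc 0 T := by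
    intro t ht
    filter_upwards [hpos] with n hn
    exact ⟨by positivity, (floor_mul_le ht.1 hn).trans ht.2⟩
  have hER : ∀ t ∈ Icc 0 T, ∀ᶠ n in atTop, ‖eul W WW (h n) 0 ξ ⌊t / h n⌋₊‖ ≤ R := by
    intro t ht
    filter_upwards [hpos, hle₁, hgrid t ht] with n hn hn1 hg
    exact HR (h n) hn hn1 0 le_rfl ξ le_rfl _ (by linarith [hg.2])
  have hYR : ∀ t ∈ Icc 0 T, ‖Y t‖ ≤ R := fun t ht => le_of_tendsto (hY t ht).norm (hER t ht)
  have hY0 : Y 0 = ξ := by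
    refine tendsto_nhds_unique (hY 0 ⟨le_rfl, hT.le⟩) ?_
    simp [eul]
  have hYerr : ∀ s ∈ Icc 0 T, ∀ t ∈ Icc 0 T, s < t → t - s < τ →
      ‖Y t - step W WW s t (Y s)‖ ≤ L * (t - s) ^ (3 * α) := by
    intro s hs t ht hst hsτ
    have fs := (tendsto_floor_mul hs.1).comp hh
    have ft := (tendsto_floor_mul ht.1).comp hh
    -- The scheme only knows grid times, so the end points of the step move with the mesh.
    have lim1 : Tendsto (fun n => ‖eul W WW (h n) 0 ξ ⌊t / h n⌋₊
        - step W WW (⌊s / h n⌋₊ * h n) (⌊t / h n⌋₊ * h n) (eul W WW (h n) 0 ξ ⌊s / h n⌋₊)‖)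
        atTop (𝓝 ‖Y t - step W WW s t (Y s)‖) :=
      ((hY t ht).sub ((hY s hs).add (tendsto_disp hα hlb hc hs ht (hgrid s hs) (hgrid t ht)
        fs ft (hY s hs)))).norm
    have lim2 : Tendsto (fun n => L * (⌊t / h n⌋₊ * h n - ⌊s / h n⌋₊ * h n) ^ (3 * α)) atTop
        (𝓝 (L * (t - s) ^ (3 * α))) :=
      ((ft.sub fs).rpow_const (Or.inr (by linarith))).const_mul L
    refine le_of_tendsto_of_tendsto lim1 lim2 ?_
    filter_upwards [hpos, hle₂, hER s hs, hgrid s hs, hgrid t ht,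
      (ft.sub fs).eventually_lt_const hsτ] with n hn hn2 hE hgs hgt hlt
    simp only [Function.comp] at hlt
    have hst' : ⌊s / h n⌋₊ ≤ ⌊t / h n⌋₊ := by gcongr
    obtain ⟨j, hj⟩ := Nat.exists_eq_add_of_le hst'
    rw [hj] at hgt hlt ⊢
    set i := ⌊s / h n⌋₊
    have e1 : ((i + j : ℕ) : ℝ) * h n = i * h n + j * h n := by push_cast; ring
    rw [e1] at hgt hlt ⊢
    have := HL (h n) hn hn2 (i * h n) hgs.1 (eul W WW (h n) 0 ξ i) hE j hgt.2 (by linarith)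
    rw [eul_add, zero_add, add_sub_cancel_left]
    exact this
  have := isSolution_of_error hp hlb hR0 hYR hL hτ hYerr
  rw [hY0] at this
  exact ⟨Y, h, this, hh, hY⟩

/-- The right-hand schemes depend on the solution only through ξ, which is the source of uniqueness.
-/
theorem IsSolution.tendsto_eul (hp : 1 < 3 * α)
    (hlb : LocallyBounded T α W WW) (hc : ChenDiag T W WW) (heb : EulerBounded T W WW) {ξ : V}
    {Z : ℝ → V} (hZ : IsSolution T α W WW ξ Z) {t : ℝ} (ht : t ∈ Icc 0 T) :
    Tendsto (fun h => eul W WW h 0 ξ ⌊t / h⌋₊) (𝓝[>] 0) (𝓝 (Z t)) := by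
  have hcont := hZ.controlled.holder.continuousOn (by linarith)
  obtain ⟨R, hR⟩ := isCompact_Icc.exists_bound_of_continuousOn hcont
  obtain ⟨L, hL, hLerr⟩ := hZ.exists_error hp hlb hc ((norm_nonneg _).trans (hR t ht)) hR
  rw [← hZ.init]
  exact tendsto_eul_of_error hp hlb hc heb ⟨R, hR⟩ hcont hL hLerr ht

end Existence

end NonlinearRough

/-! ### Existence and uniqueness. -/

theorem theorem4p3 {V : Type*} [NormedAddCommGroup V] [NormedSpace ℝ V] [CompleteSpace V]
    [TopologicalSpace.SeparableSpace V]
    (α : ℝ) (hα : 1 / 3 < α) (hα' : α ≤ 1 / 2)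
    (β : ℕ → ℝ) (hβ : ∀ k ≤ 3, 0 ≤ β k)
    (γ₂ : ℝ) (hγ₂ : γ₂ = max (β 0) (max (β 1) (β 2)) + max (β 1) (max (β 2) (β 3)) + β 1)
    (hH : γ₂ / α - γ₂ + β 0 ≤ 1)
    (T : ℝ) (hT : 0 < T)
    (W : ℝ → V → V) (WW : ℝ → ℝ → V × V → V)
    (hW : NonlinearRough.IsNonlinearRoughPath T α 3 β W WW)
    (ξ : V) :
    ∃ Y : ℝ → V, NonlinearRough.IsSolution T α W WW ξ Y ∧
      ∀ Z : ℝ → V, NonlinearRough.IsSolution T α W WW ξ Z → Set.EqOn Z Y (Set.Icc 0 T) := by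
  have hp : 1 < 3 * α := by linarith
  have hc := hW.chenDiag
  obtain ⟨C, hC, hb⟩ := hW.exists_boundsOn (by linarith) hβ
  have hlb := NonlinearRough.locallyBounded_of_growth hC hb
  have heb : NonlinearRough.EulerBounded T W WW := fun ρ hρ =>
    NonlinearRough.exists_eul_bound hp hβ hγ₂ hH hC hb hc ρ hρ
  obtain ⟨Y, h, hY, hh, hlim⟩ := NonlinearRough.exists_isSolution hp hα' hT hlb hc heb ξ
  exact ⟨Y, hY, fun Z hZ t ht =>
    tendsto_nhds_unique ((hZ.tendsto_eul hp hlb hc heb ht).comp hh) (hlim t ht)⟩
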